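/- Theorem 5. A bidder takes part in $T$ rounds of first-price auctions. In round $t$ she observes her private value $v_t\in[0,1]$ and a hint interval $(h_t,\sigma_t)$ with $h_t\in[0,1]$, $\sigma_t\ge 0$; knowing also $(v_s,h_s,\sigma_s,m_s)_{s<t}$, she places a (possibly randomized) bid $b_t\in[0,v_t]$; then the highest competing bid $m_t\in[0,1]$ is revealed and she earns $r(b_t;v_t,m_t)=(v_t-b_t)\mathbf 1\{b_t\ge m_t\}$. The sequences $(v_t)$ and $(\sigma_t)$ are arbitrary with $\sum_{t=1}^T\sigma_t=L$; the joint law of $(m_t,h_t)_{t\le T}$ is arbitrary, not reacting to the bids, subject to $\mathbb E|h_t-m_t|^q\le\sigma_t^q$ for every $t$ and to all $m_t$ lying almost surely in a set of at most $K$ points of $[0,1]$, which is not revealed to the bidder. For a bidding policy $\pi$ let $$\mathrm{Reg}(\pi)=\mathbb E\Big[\sup_{a\in\mathcal F}\sum_{t=1}^T r(a(v_t);v_t,m_t)-\sum_{t=1}^T r(b_t;v_t,m_t)\Big],$$ where $\mathcal F$ is the set of nondecreasing $1$-Lipschitz maps $[0,1]\to[0,1]$. Let $R(T,K,q,L)=\inf_\pi\sup\mathrm{Reg}(\pi)$,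 where the supremum is over all such $\{v_t,m_t,h_t,\sigma_t\}$ and the infimum is over all policies (which may depend on $T,K,q,L$). There are absolute constants $C,c>0$ such that for all real $q\ge 1$, integers $T$ and $K$, and $L\in[1,T]$: (upper bound) if $T\ge 2$ and $K\ge 1$, then $$R(T,K,q,L)\le C\min\Big\{\sqrt{\log T\cdot T^{\frac1{q+1}}L^{\frac q{q+1}}K},\ T^{\frac1{q+1}}L^{\frac q{q+1}},\ \sqrt T\,\bigl(1+\log\min\{K,T\}\bigr)\Big\};$$ (lower bound) if $T\ge 1$ and $K\ge 2$, then $$R(T,K,q,L)\ge c\min\Big\{\sqrt{T^{\frac1{q+1}}L^{\frac q{q+1}}K},\ T^{\frac1{q+1}}L^{\frac q{q+1}},\ \sqrt T\Big\}.$$ -/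

import Mathlib

open MeasureTheory ProbabilityTheory
open scoped unitInterval NNReal

noncomputable section

namespace FirstPrice

/-- Instantaneous reward of the bid `b` at private value `v` when the highest competing
bid is `m`: `(v - b) * 1{b ≥ m}`. -/
def reward (b v m : I) : ℝ := if m ≤ b then (v : ℝ) - (b : ℝ) else 0

/-- The competing bidding oracles: nondecreasing 1-Lipschitz maps from `[0,1]` to `[0,1]`. -/
abbrev Oracle : Type := {a : I → I // LipschitzWith 1 a ∧ Monotone a}

/-- What the bidder knows when she bids in round `t`: private value, hint and hint accuracy
`(v_s, h_s, σ_s)` for `s ≤ t`, and the highest competing bids `m_s` for `s < t`. -/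
abbrev History {T : ℕ} (t : Fin T) : Type :=
  (Set.Iic t → I × I × ℝ≥0) × (Set.Iio t → I)

/-- The private value of the current round. -/
def History.value {T : ℕ} {t : Fin T} (x : History t) : I := (x.1 ⟨t, le_refl t⟩).1

/-- A randomized bidding policy for hint intervals: in round `t` the bid is drawn from a law on
`[0, v_t]` that depends (measurably) on the history only. The environment does not react to the
bids, so letting the law depend also on the bidder's own earlier bids would not change the
attainable expected rewards. -/
structure Policy (T : ℕ) where
  bid : (t : Fin T) → Kernel (History t) I
  isMarkov : ∀ t, IsMarkovKernel (bid t)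
  bid_le_value : ∀ (t : Fin T) (x : History t), ∀ᵐ b ∂(bid t x), b ≤ x.value

/-- An environment over `T` rounds with `K`-sparse highest competing bids, hint exponent `q` and
total hint error `L`. Private values and accuracies are arbitrary sequences; the pairs
`(m_t, h_t)` of highest competing bid and hint have an arbitrary joint law, subject to
`E |h_t - m_t| ^ q ≤ σ_t ^ q` with `σ_t = acc t`; almost surely all `m_t` lie in a fixed set of at most `K` points
(which is not revealed to the bidder). -/
structure Environment (T K : ℕ) (q L : ℝ) where
  v : Fin T → I
  acc : Fin T → ℝ≥0
  law : Measure (Fin T → I × I)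
  isProb : IsProbabilityMeasure law
  hint : ∀ t, ∫ ω, |((ω t).2 : ℝ) - ((ω t).1 : ℝ)| ^ q ∂law ≤ (acc t : ℝ) ^ q
  total : ∑ t, (acc t : ℝ) = L
  sparse : ∃ S : Finset I, S.card ≤ K ∧ ∀ᵐ ω ∂law, ∀ t, (ω t).1 ∈ S

variable {T K : ℕ} {q L : ℝ}

/-- The history in round `t` on the realization `ω` of the pairs `(m_s, h_s)`. -/
def Environment.history (E : Environment T K q L) (ω : Fin T → I × I) (t : Fin T) : History t :=
  (fun s => (E.v s, (ω s).2, E.acc s), fun s => (ω s).1)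

/-- Cumulative reward of the best oracle in hindsight. -/
def Environment.best (E : Environment T K q L) (ω : Fin T → I × I) : ℝ :=
  ⨆ a : Oracle, ∑ t, reward (a.1 (E.v t)) (E.v t) (ω t).1

/-- Cumulative reward of a policy on the realization `ω`, averaged over the policy's coins. -/
def Environment.gain (E : Environment T K q L) (π : Policy T) (ω : Fin T → I × I) : ℝ :=
  ∑ t, ∫ b, reward b (E.v t) (ω t).1 ∂(π.bid t (E.history ω t))

/-- Expected regret against the best oracle in hindsight. -/
def regret (π : Policy T) (E : Environment T K q L) : ℝ :=
  ∫ ω, (E.best ω - E.gain π ω) ∂E.law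

/-- The minimax regret `inf_π sup_E Reg(π)`, for known `T`, `K`, `q`, `L`. -/
def minimaxRegret (T K : ℕ) (q L : ℝ) : EReal :=
  ⨅ π : Policy T, ⨆ E : Environment T K q L, ((regret π E : ℝ) : EReal)

/-- The cost `T^{1/(q+1)} L^{q/(q+1)}` of bidding from the hints alone. -/
def hintRate (T : ℕ) (q L : ℝ) : ℝ := (T : ℝ) ^ (1 / (q + 1)) * L ^ (q / (q + 1))

end FirstPrice

end

/-! Upper bound: each of the three terms is achieved by its own policy; write `H` for `hintRate T q
L`.

Hints alone. Bid `h + d` with `d` about `σ ^ (q/(q+1))`. Compared with knowing `m`, the loss is at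
most `2d` if `|h - m| ≤ d`, and otherwise at most `1 ≤ (|h - m|/d) ^ q`. This `d` balances the two
parts, and a power-mean inequality sums the margins to `O(H)`.

Sparsity. An oracle matters only through the values at which it reaches each of the `K` points, so
about `T ^ (2K)` step functions on a grid replace all oracles. Exponential weights over them and the
hint bid have a first-order bound (`hedge_regret_le`): regret is of order `√(loss · log N)`, where
the loss of the hint bid is `O(H)` in expectation.

Chaining. Raising a bid by `δ` without exceeding the value costs at most `δ`, whereas lowering it
can lose the auction. Oracles are therefore approximated from above along a tree, and each node
hedges over its children's strategies with its own bid as reference, which no descendant beats by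
more than `2 · 2 ^ (-j)`. Level `j` costs `√(2 ^ (-j) · T · log(#labels))` (`exists_chaining`).
Labels have entropy `O(2 ^ j)` while `2 ^ j` is below `K` and `O(K)` afterwards (`exists_labels`),
so about `log K` levels cost `O(√T)` each and the rest form a geometric series.

Lower bound: rounds cycle through `n` values. At each value the competing bid sits at a grid point
or, with small probability, one step `δ` higher, with the same hint, so that no bid beats the
certain high bid in expectation. In hindsight an oracle picks the better of two bids separately in
every bin. This gains the positive part of a centred sum, bounded below by second and fourth
moments, for a total of order `√(n δ T)` (`HardParams.regret_ge`). -/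

namespace FirstPrice

/-! ### Exponential weights with a first-order regret bound. -/

/-- One step of the exponential-weights potential. -/
lemma sum_mul_exp_neg_le {κ : Type*} [Fintype κ] (w l : κ → ℝ) (hw : ∀ k, 0 ≤ w k)
    (hl0 : ∀ k, 0 ≤ l k) (hl1 : ∀ k, l k ≤ 3) {η : ℝ} (hη : 0 ≤ η) :
    ∑ k, w k * Real.exp (-(η * l k)) ≤
      ∑ k, w k - η * (1 - 3 / 2 * η) * ∑ k, w k * l k := by
  rw [Finset.mul_sum, ← Finset.sum_sub_distrib]
  refine Finset.sum_le_sum fun k _ => ?_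
  have hx : 0 ≤ η * l k := mul_nonneg hη (hl0 k)
  have h1 : Real.exp (-(η * l k)) ≤ 1 - η * l k + (η * l k) ^ 2 / 2 := by
    set x := η * l k
    have h := Real.quadratic_le_exp_of_nonneg hx
    rw [Real.exp_neg, inv_le_comm₀ (Real.exp_pos _) (by nlinarith [sq_nonneg (x - 1)])]
    refine le_trans ?_ h
    -- `(1 + x + x²/2)(1 - x + x²/2) = 1 + x⁴/4`.
    rw [inv_le_iff_one_le_mul₀ (by nlinarith [sq_nonneg (x - 1)])]
    nlinarith [sq_nonneg (x ^ 2)]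
  -- The second-order term is dominated by the loss itself, so the regret scales with the cumulative
  -- loss instead of with `T`.
  have h2 : (η * l k) ^ 2 / 2 ≤ 3 / 2 * η * (η * l k) := by
    nlinarith [mul_nonneg hη hx, mul_le_mul_of_nonneg_left (hl1 k) (mul_nonneg hη hx)]
  nlinarith [mul_le_mul_of_nonneg_left (h1.trans (add_le_add_right h2 _)) (hw k)]

/-- Exponential weights on cumulative rewards. -/
noncomputable def expWeight {κ : Type*} [Fintype κ] (η : ℝ) (G : ℕ → κ → ℝ) (t : ℕ) (k : κ) : ℝ :=
  Real.exp (η * ∑ s ∈ Finset.range t, G s k) /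
    ∑ k', Real.exp (η * ∑ s ∈ Finset.range t, G s k')

section expWeight
variable {κ : Type*} [Fintype κ]

lemma expWeight_nonneg (η : ℝ) (G : ℕ → κ → ℝ) (t : ℕ) (k : κ) : 0 ≤ expWeight η G t k := by
  unfold expWeight; positivity

lemma sum_expWeight [Nonempty κ] (η : ℝ) (G : ℕ → κ → ℝ) (t : ℕ) :
    ∑ k, expWeight η G t k = 1 := by
  unfold expWeight
  rw [← Finset.sum_div, div_self]
  exact (Finset.sum_pos (fun _ _ => Real.exp_pos _) Finset.univ_nonempty).ne'

/-- First-order regret bound of exponential weights. -/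
lemma expWeight_loss_le [Nonempty κ] {η : ℝ} (hη : 0 < η) (hη3 : η ≤ 1 / 3) (G : ℕ → κ → ℝ)
    (u : ℕ → ℝ) (T : ℕ) (h0 : ∀ t < T, ∀ k, G t k ≤ u t) (h3 : ∀ t < T, ∀ k, u t - G t k ≤ 3)
    (k : κ) :
    ∑ t ∈ Finset.range T, (u t - ∑ k', expWeight η G t k' * G t k') ≤
      (1 + 3 * η) * ∑ t ∈ Finset.range T, (u t - G t k)
        + 2 * Real.log (Fintype.card κ) / η := by
  set Φ : ℕ → ℝ := fun t => ∑ k', Real.exp (-(η * ∑ s ∈ Finset.range t, (u s - G s k')))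
  have hΦpos : ∀ t, 0 < Φ t := fun t =>
    Finset.sum_pos (fun _ _ => Real.exp_pos _) Finset.univ_nonempty
  -- Passing from rewards to losses against `u` multiplies all weights by a common factor, which
  -- cancels.
  have hwt : ∀ t k', expWeight η G t k' =
      Real.exp (-(η * ∑ s ∈ Finset.range t, (u s - G s k'))) / Φ t := by
    intro t k'
    have he : ∀ k'', Real.exp (-(η * ∑ s ∈ Finset.range t, (u s - G s k''))) =
        Real.exp (-(η * ∑ s ∈ Finset.range t, u s)) *
          Real.exp (η * ∑ s ∈ Finset.range t, G s k'') := by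
      intro k''
      rw [← Real.exp_add, Finset.sum_sub_distrib]; ring_nf
    simp only [Φ, expWeight, he, ← Finset.mul_sum]
    rw [mul_div_mul_left _ _ (Real.exp_pos _).ne']
  set A : ℕ → ℝ := fun t => u t - ∑ k', expWeight η G t k' * G t k'
  have hA : ∀ t, A t = ∑ k', expWeight η G t k' * (u t - G t k') := by
    intro t
    simp only [A, mul_sub, Finset.sum_sub_distrib, ← Finset.sum_mul, sum_expWeight, one_mul]
  have hstep : ∀ t < T, Φ (t + 1) ≤ Φ t * Real.exp (-(η * (1 - 3 / 2 * η) * A t)) := by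
    intro t ht
    have h1 := sum_mul_exp_neg_le (expWeight η G t) (fun k' => u t - G t k')
      (expWeight_nonneg η G t) (fun k' => sub_nonneg.2 (h0 t ht k')) (h3 t ht) hη.le
    rw [sum_expWeight, ← hA] at h1
    have h2 : Φ (t + 1) =
        Φ t * ∑ k', expWeight η G t k' * Real.exp (-(η * (u t - G t k'))) := by
      rw [Finset.mul_sum]
      refine Finset.sum_congr rfl fun k' _ => ?_
      rw [hwt, Finset.sum_range_succ, ← mul_assoc, mul_div_cancel₀ _ (hΦpos t).ne',
        ← Real.exp_add]
      ring_nf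
    rw [h2]
    refine mul_le_mul_of_nonneg_left (h1.trans ?_) (hΦpos t).le
    have := Real.add_one_le_exp (-(η * (1 - 3 / 2 * η) * A t))
    linarith
  have hmain : ∀ t ≤ T, Φ t ≤ Fintype.card κ *
      Real.exp (-(η * (1 - 3 / 2 * η) * ∑ s ∈ Finset.range t, A s)) := by
    intro t
    induction t with
    | zero => intro _; simp [Φ]
    | succ t ih =>
      intro ht
      refine (hstep t ht).trans ((mul_le_mul_of_nonneg_right (ih (by omega))
        (Real.exp_pos _).le).trans (le_of_eq ?_))
      rw [mul_assoc, ← Real.exp_add, Finset.sum_range_succ]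
      ring_nf
  have hk : Real.exp (-(η * ∑ s ∈ Finset.range T, (u s - G s k))) ≤ Φ T :=
    Finset.single_le_sum (f := fun k' =>
      Real.exp (-(η * ∑ s ∈ Finset.range T, (u s - G s k'))))
      (fun _ _ => (Real.exp_pos _).le) (Finset.mem_univ k)
  have hcard : (0 : ℝ) < Fintype.card κ := by exact_mod_cast Fintype.card_pos
  have hlog := Real.log_le_log (Real.exp_pos _) (hk.trans (hmain T le_rfl))
  rw [Real.log_exp, Real.log_mul hcard.ne' (Real.exp_pos _).ne', Real.log_exp] at hlog
  set LA := ∑ s ∈ Finset.range T, A s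
  set Lk := ∑ s ∈ Finset.range T, (u s - G s k)
  have hLk : 0 ≤ Lk := Finset.sum_nonneg fun s hs =>
    sub_nonneg.2 (h0 s (Finset.mem_range.1 hs) k)
  have hN : 0 ≤ Real.log (Fintype.card κ) :=
    Real.log_nonneg (by exact_mod_cast Fintype.card_pos)
  set N := Real.log (Fintype.card κ)
  have h4 : (1 - 3 / 2 * η) * LA ≤ Lk + N / η := by
    rw [← sub_le_iff_le_add', le_div_iff₀ hη]; nlinarith
  have hpos : 0 < 1 - 3 / 2 * η := by linarith
  have h5 : LA ≤ (1 + 3 * η) * (Lk + N / η) := by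
    -- The product equals `1 + (3/2) η (1 - 3η)`; this is where `η ≤ 1/3` is needed.
    have h6 : 1 ≤ (1 - 3 / 2 * η) * (1 + 3 * η) := by nlinarith
    have h7 : 0 ≤ Lk + N / η := by positivity
    by_contra! hc
    nlinarith [mul_lt_mul_of_pos_left hc hpos, mul_le_mul_of_nonneg_right h6 h7]
  have h8 : 3 * η * (N / η) ≤ N / η := by
    have : 0 ≤ N / η := by positivity
    nlinarith
  have h9 : 2 * N / η = N / η + N / η := by ring
  nlinarith

end expWeight

/-! ### Strategies over experts, hedging and chaining. -/

/-- A randomized strategy for prediction with expert advice over the experts `ι`: in round `t` it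
plays a probability vector that depends only on the reward vectors of the rounds before `t`. -/
structure Strategy (ι : Type*) [Fintype ι] where
  weight : ℕ → (ℕ → ι → ℝ) → ι → ℝ
  nonneg : ∀ t g i, 0 ≤ weight t g i
  sum_one : ∀ t g, ∑ i, weight t g i = 1
  causal : ∀ t g g', (∀ s < t, g s = g' s) → weight t g = weight t g'
  meas : ∀ t i, Measurable fun g => weight t g i

namespace Strategy
variable {ι : Type*} [Fintype ι]

/-- Expected reward of the strategy in round `t`. -/
def gain (A : Strategy ι) (g : ℕ → ι → ℝ) (t : ℕ) : ℝ := ∑ i, A.weight t g i * g t i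

lemma gain_le (A : Strategy ι) {g : ℕ → ι → ℝ} {t : ℕ} {c : ℝ} (h : ∀ i, g t i ≤ c) :
    A.gain g t ≤ c := by
  calc A.gain g t ≤ ∑ i, A.weight t g i * c :=
        Finset.sum_le_sum fun i _ => mul_le_mul_of_nonneg_left (h i) (A.nonneg t g i)
    _ = c := by rw [← Finset.sum_mul, A.sum_one, one_mul]

lemma gain_nonneg (A : Strategy ι) {g : ℕ → ι → ℝ} {t : ℕ} (h : ∀ i, 0 ≤ g t i) :
    0 ≤ A.gain g t :=
  Finset.sum_nonneg fun i _ => mul_nonneg (A.nonneg t g i) (h i)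

lemma gain_congr (A : Strategy ι) {g g' : ℕ → ι → ℝ} {t : ℕ} (h : ∀ s ≤ t, g s = g' s) :
    A.gain g t = A.gain g' t := by
  unfold gain
  rw [A.causal t g g' fun s hs => h s hs.le, h t le_rfl]

lemma measurable_gain (A : Strategy ι) (t : ℕ) : Measurable fun g => A.gain g t := by
  unfold gain
  refine Finset.measurable_sum _ fun i _ => (A.meas t i).mul ?_
  exact (measurable_pi_apply i).comp (measurable_pi_apply t)

/-- The strategy that always follows the expert `i`. -/
def const [DecidableEq ι] (i : ι) : Strategy ι where
  weight _ _ := Pi.single i 1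
  nonneg _ _ j := by
    by_cases h : j = i
    · subst h; simp
    · simp [h]
  sum_one _ _ := by simp
  causal _ _ _ _ := rfl
  meas _ _ := measurable_const

@[simp] lemma gain_const [DecidableEq ι] (i : ι) (g : ℕ → ι → ℝ) (t : ℕ) :
    (const i).gain g t = g t i := by
  simp [gain, const, Pi.single_apply]

variable {κ : Type*} [Fintype κ] [Nonempty κ]

/-- Exponential weights over a finite family of strategies. -/
noncomputable def hedge (η : ℝ) (A : κ → Strategy ι) : Strategy ι where
  weight t g i := ∑ k, expWeight η (fun s k => (A k).gain g s) t k * (A k).weight t g i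
  nonneg t g i := Finset.sum_nonneg fun k _ =>
    mul_nonneg (expWeight_nonneg _ _ _ _) ((A k).nonneg t g i)
  sum_one t g := by
    rw [Finset.sum_comm]
    simp only [← Finset.mul_sum, (A _).sum_one, mul_one, sum_expWeight]
  causal t g g' h := by
    funext i
    refine Finset.sum_congr rfl fun k _ => ?_
    have : ∀ k', ∑ s ∈ Finset.range t, (A k').gain g s =
        ∑ s ∈ Finset.range t, (A k').gain g' s := fun k' =>
      Finset.sum_congr rfl fun s hs => (A k').gain_congr fun s' hs' =>
        h s' (lt_of_le_of_lt hs' (Finset.mem_range.1 hs))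
    simp only [expWeight, this, (A k).causal t g g' h]
  meas t i := by
    refine Finset.measurable_sum _ fun k _ => Measurable.mul ?_ ((A k).meas t i)
    have : ∀ k', Measurable fun g : ℕ → ι → ℝ =>
        Real.exp (η * ∑ s ∈ Finset.range t, (A k').gain g s) := fun k' =>
      Real.measurable_exp.comp (measurable_const.mul
        (Finset.measurable_sum _ fun s _ => (A k').measurable_gain s))
    unfold expWeight
    exact (this k).div (Finset.measurable_sum _ fun k' _ => this k')

lemma gain_hedge (η : ℝ) (A : κ → Strategy ι) (g : ℕ → ι → ℝ) (t : ℕ) :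
    (hedge η A).gain g t =
      ∑ k, expWeight η (fun s k => (A k).gain g s) t k * (A k).gain g t := by
  simp only [gain, hedge, Finset.sum_mul, Finset.mul_sum]
  rw [Finset.sum_comm]
  exact Finset.sum_congr rfl fun _ _ => Finset.sum_congr rfl fun _ _ => by ring

lemma gain_hedge_le (η : ℝ) (A : κ → Strategy ι) {g : ℕ → ι → ℝ} {t : ℕ} {c : ℝ}
    (h : ∀ k, (A k).gain g t ≤ c) : (hedge η A).gain g t ≤ c := by
  rw [gain_hedge]
  calc _ ≤ ∑ k, expWeight η (fun s k => (A k).gain g s) t k * c :=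
        Finset.sum_le_sum fun k _ => mul_le_mul_of_nonneg_left (h k) (expWeight_nonneg _ _ _ _)
    _ = c := by rw [← Finset.sum_mul, sum_expWeight, one_mul]

/-- Regret of `hedge` against every member `k` in terms of the cumulative loss of a reference
member `k₀`, losses being measured from an upper envelope `u` of the rewards. -/
lemma hedge_regret_le {η : ℝ} (hη : 0 < η) (hη3 : η ≤ 1 / 3) (A : κ → Strategy ι)
    (g : ℕ → ι → ℝ) (u : ℕ → ℝ) (T : ℕ) (h0 : ∀ t < T, ∀ k, (A k).gain g t ≤ u t)
    (h3 : ∀ t < T, ∀ k, u t - (A k).gain g t ≤ 3) (k k₀ : κ) :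
    ∑ t ∈ Finset.range T, (A k).gain g t - ∑ t ∈ Finset.range T, (hedge η A).gain g t ≤
      3 * η * ∑ t ∈ Finset.range T, (u t - (A k₀).gain g t)
        + 2 * Real.log (Fintype.card κ) / η := by
  have key : ∀ k : κ, ∑ t ∈ Finset.range T, (A k).gain g t -
      ∑ t ∈ Finset.range T, (hedge η A).gain g t ≤
      3 * η * ∑ t ∈ Finset.range T, (u t - (A k).gain g t)
        + 2 * Real.log (Fintype.card κ) / η := by
    intro k
    have h := expWeight_loss_le hη hη3 (fun s k => (A k).gain g s) u T h0 h3 k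
    simp only [← gain_hedge, Finset.sum_sub_distrib] at h ⊢
    linarith
  -- If `k` collects more than `k₀`, its loss is the smaller one; otherwise the regret against `k`
  -- is at most that against `k₀`.
  rcases le_total (∑ t ∈ Finset.range T, (A k₀).gain g t)
    (∑ t ∈ Finset.range T, (A k).gain g t) with h | h
  · refine (key k).trans ?_
    simp only [Finset.sum_sub_distrib]
    have := mul_le_mul_of_nonneg_left h (by positivity : 0 ≤ 3 * η)
    linarith
  · linarith [key k₀]

/-- If a reference expert `i₀` is never worse than any member of a family by more than `Δ`, then
some strategy that stays below the same envelope has regret `7 √(Δ T log (N + 1))`. -/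
lemma exists_regret_le_of_good_expert {κ : Type*} [Fintype κ] [Nonempty κ] [DecidableEq ι]
    (A : κ → Strategy ι) (i₀ : ι)
    (T : ℕ) {Δ : ℝ} (hΔ : 0 ≤ Δ) (hΔ2 : Δ ≤ 2) :
    ∃ B : Strategy ι,
      ∀ g : ℕ → ι → ℝ, (∀ t i, 0 ≤ g t i) → (∀ t i, g t i ≤ 1) →
        (∀ t k, (A k).gain g t ≤ g t i₀ + Δ) →
        (∀ t, B.gain g t ≤ g t i₀ + Δ) ∧
        ∀ k, ∑ t ∈ Finset.range T, (A k).gain g t - ∑ t ∈ Finset.range T, B.gain g t ≤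
          7 * √(Δ * T * Real.log (Fintype.card κ + 1)) := by
  set N := Real.log (Fintype.card κ + 1)
  have hN : 0 < N := Real.log_pos (by
    have : (0 : ℝ) < Fintype.card κ := by exact_mod_cast Fintype.card_pos
    linarith)
  have hT : (0 : ℝ) ≤ T := Nat.cast_nonneg T
  -- When `Δ T ≤ log (N + 1)`, following `i₀` loses at most `Δ T`, which is already below the square
  -- root.
  rcases le_or_gt (Δ * T) N with hc | hc
  · refine ⟨const i₀, fun g _ _ hA => ⟨fun t => by simpa using hΔ, fun k => ?_⟩⟩
    have h1 : ∑ t ∈ Finset.range T, (A k).gain g t -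
        ∑ t ∈ Finset.range T, (const i₀).gain g t ≤ Δ * T := by
      rw [← Finset.sum_sub_distrib]
      calc _ ≤ ∑ t ∈ Finset.range T, Δ := Finset.sum_le_sum fun t _ => by
            simpa using by linarith [hA t k]
        _ = Δ * T := by simp [mul_comm]
    have h2 : Δ * T ≤ √(Δ * T * N) := Real.le_sqrt_of_sq_le (by
      rw [sq]; exact mul_le_mul_of_nonneg_left hc (by positivity))
    have := Real.sqrt_nonneg (Δ * T * N)
    linarith
  -- With this rate `3η · ΔT = √(ΔTN)` and `2N/η = 6√(ΔTN)`, whence the factor `7`.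
  · set η := √(N / (Δ * T)) / 3
    have hΔT : 0 < Δ * T := hN.trans hc
    have hη : 0 < η := by positivity
    have hη3 : η ≤ 1 / 3 := by
      have : √(N / (Δ * T)) ≤ 1 := Real.sqrt_le_one.2 ((div_le_one hΔT).2 hc.le)
      simp only [η]; linarith
    -- The reference expert joins the family, which makes the logarithm `log (N + 1)`. Against the
    -- envelope `g t i₀ + Δ` its total loss is exactly `Δ T`, and all losses are at most `1 + 2`.
    let A' : Option κ → Strategy ι := fun o => o.elim (const i₀) A
    refine ⟨hedge η A', fun g hg0 hg1 hA => ?_⟩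
    have hA' : ∀ t o, (A' o).gain g t ≤ g t i₀ + Δ := by
      intro t o
      cases o with
      | none => simpa [A'] using hΔ
      | some k => exact hA t k
    refine ⟨fun t => gain_hedge_le η A' (hA' t), fun k => ?_⟩
    have h := hedge_regret_le hη hη3 A' g (fun t => g t i₀ + Δ) T (fun t _ => hA' t)
      (fun t _ o => by linarith [(A' o).gain_nonneg (hg0 t), hg1 t i₀]) (some k) none
    have hsum : ∑ t ∈ Finset.range T, (g t i₀ + Δ - (A' none).gain g t) = Δ * T := by
      simp [A', mul_comm]
    rw [hsum] at h
    have hcard : Real.log (Fintype.card (Option κ)) = N := by simp [N]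
    rw [hcard] at h
    refine h.trans (le_of_eq ?_)
    have e1 : √(Δ * T * N) = √(Δ * T) * √N := Real.sqrt_mul hΔT.le _
    have e2 : √(N / (Δ * T)) = √N / √(Δ * T) := Real.sqrt_div hN.le _
    have s1 := Real.mul_self_sqrt hN.le
    have s2 := Real.mul_self_sqrt hΔT.le
    have p1 : 0 < √N := Real.sqrt_pos.2 hN
    have p2 : 0 < √(Δ * T) := Real.sqrt_pos.2 hΔT
    simp only [η, e1, e2]
    rw [← s2, ← s1]
    simp only [Real.sqrt_mul_self p1.le, Real.sqrt_mul_self p2.le]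
    field_simp
    ring

/-- Chaining along a tree of experts. The expert `(j, x)` depends on the first `j` labels of the
path `x` only, and refining it by one more label improves no reward by more than `δ j`. -/
theorem exists_chaining {J : ℕ} {X : Fin J → Type} [∀ j, Fintype (X j)] [∀ j, Nonempty (X j)]
    [DecidableEq (∀ j, X j)] (T : ℕ) (δ : ℕ → ℝ) (hδ : ∀ j, 0 ≤ δ j)
    (hδ2 : ∀ j ≤ J, ∑ i ∈ Finset.Ico j J, δ i ≤ 2) (x₀ : ∀ j, X j) :
    ∃ B : Strategy (Fin (J + 1) × ∀ j, X j), ∀ g : ℕ → (Fin (J + 1) × ∀ j, X j) → ℝ,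
      (∀ t i, 0 ≤ g t i) → (∀ t i, g t i ≤ 1) →
      (∀ t (j : Fin (J + 1)) x y, (∀ i : Fin J, (i : ℕ) < j → x i = y i) →
        g t (j, x) = g t (j, y)) →
      (∀ t (j : Fin J) x, g t (j.succ, x) ≤ g t (j.castSucc, x) + δ j) →
      ∀ x, ∑ t ∈ Finset.range T, g t (Fin.last J, x) - ∑ t ∈ Finset.range T, B.gain g t ≤
        ∑ j : Fin J, 7 * √((∑ i ∈ Finset.Ico (j : ℕ) J, δ i) * T *
          Real.log (Fintype.card (X j) + 1)) := by
  set cost : ℕ → ℝ := fun j => if h : j < J then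
    7 * √((∑ i ∈ Finset.Ico j J, δ i) * T * Real.log (Fintype.card (X ⟨j, h⟩) + 1)) else 0
  -- Induction from the leaves towards the root. The first conclusion, that the strategy of a node
  -- never beats the node's own expert by more than the remaining `δ`'s, is what lets the parent use
  -- its expert as reference.
  have key : ∀ n j : ℕ, ∀ hj : j ≤ J, J - j = n → ∀ x : (∀ j, X j),
      ∃ B : Strategy (Fin (J + 1) × ∀ j, X j), ∀ g : ℕ → (Fin (J + 1) × ∀ j, X j) → ℝ,
      (∀ t i, 0 ≤ g t i) → (∀ t i, g t i ≤ 1) →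
      (∀ t (j : Fin (J + 1)) x y, (∀ i : Fin J, (i : ℕ) < j → x i = y i) →
        g t (j, x) = g t (j, y)) →
      (∀ t (j : Fin J) x, g t (j.succ, x) ≤ g t (j.castSucc, x) + δ j) →
      (∀ t, B.gain g t ≤ g t (⟨j, by omega⟩, x) + ∑ i ∈ Finset.Ico j J, δ i) ∧
      ∀ y, (∀ i : Fin J, (i : ℕ) < j → y i = x i) →
        ∑ t ∈ Finset.range T, g t (Fin.last J, y) - ∑ t ∈ Finset.range T, B.gain g t ≤
        ∑ i ∈ Finset.Ico j J, cost i := by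
    intro n
    induction n with
    | zero =>
      intro j hj hn x
      obtain rfl : j = J := by omega
      refine ⟨const (Fin.last j, x), fun g _ _ _ _ => ⟨fun t => by simp [Fin.last], fun y hy => ?_⟩⟩
      obtain rfl : y = x := funext fun i => hy i i.2
      simp
    | succ n ih =>
      intro j hj hn x
      have hjJ : j < J := by omega
      have hs : ∑ i ∈ Finset.Ico j J, δ i = δ j + ∑ i ∈ Finset.Ico (j + 1) J, δ i :=
        Finset.sum_eq_sum_Ico_succ_bot hjJ δ
      choose A hA using fun c : X ⟨j, hjJ⟩ =>
        ih (j + 1) hjJ (by omega) (Function.update x ⟨j, hjJ⟩ c)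
      obtain ⟨B, hB⟩ := exists_regret_le_of_good_expert A (⟨j, by omega⟩, x) T
        (Finset.sum_nonneg fun i _ => hδ i) (hδ2 j hj)
      refine ⟨B, fun g h0 h1 hdep hstep => ?_⟩
      have hAle : ∀ t c, (A c).gain g t ≤
          g t (⟨j, by omega⟩, x) + ∑ i ∈ Finset.Ico j J, δ i := by
        intro t c
        have e1 := (hA c g h0 h1 hdep hstep).1 t
        have e2 := hstep t ⟨j, hjJ⟩ (Function.update x ⟨j, hjJ⟩ c)
        have e3 := hdep t ⟨j, by omega⟩ (Function.update x ⟨j, hjJ⟩ c) x (fun i hi =>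
          Function.update_of_ne (by rintro rfl; simp at hi) _ _)
        simp only [Fin.succ_mk, Fin.castSucc_mk] at e2
        rw [hs]
        linarith
      obtain ⟨hB1, hB2⟩ := hB g h0 h1 hAle
      refine ⟨hB1, fun y hy => ?_⟩
      have e1 := (hA (y ⟨j, hjJ⟩) g h0 h1 hdep hstep).2 y (by
        intro i hi
        by_cases hij : i = ⟨j, hjJ⟩
        · subst hij; simp
        · rw [Function.update_of_ne hij]
          refine hy i ?_
          have : (i : ℕ) ≠ j := fun h => hij (Fin.ext h)
          omega)
      have e2 := hB2 (y ⟨j, hjJ⟩)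
      have e3 : cost j = 7 * √((∑ i ∈ Finset.Ico j J, δ i) * T *
          Real.log (Fintype.card (X ⟨j, hjJ⟩) + 1)) := by simp only [cost, dif_pos hjJ]
      rw [Finset.sum_eq_sum_Ico_succ_bot hjJ cost, e3]
      linarith
  obtain ⟨B, hB⟩ := key J 0 (Nat.zero_le _) (by omega) x₀
  refine ⟨B, fun g h0 h1 hdep hstep x => ?_⟩
  refine ((hB g h0 h1 hdep hstep).2 x (by simp)).trans (le_of_eq ?_)
  rw [← Finset.range_eq_Ico, Finset.sum_range]
  exact Finset.sum_congr rfl fun j _ => by simp [cost]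

end Strategy

/-! ### Counting codes. -/

/-- Monotone sequences of length `n` with values below `m` are determined, on `k < n`, by one of at
most `2 ^ (n + m)` representatives. -/
lemma exists_monotone_representatives (n m : ℕ) :
    ∃ F : Finset (ℕ → ℕ), F.Nonempty ∧ F.card ≤ 2 ^ (n + m) ∧
      ∀ f : ℕ → ℕ, Monotone f → (∀ k < n, f k < m) → ∃ f' ∈ F, ∀ k < n, f' k = f k := by
  classical
  -- For monotone `f` the map `k ↦ f k + k` is strictly increasing, hence determined by its image, a
  -- subset of `range (n + m)`. Sets that are not such an image decode to the junk value `0`.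
  let P : Finset ℕ → (ℕ → ℕ) → Prop := fun A f =>
    Monotone f ∧ (Finset.range n).image (fun k => f k + k) = A
  let dec : Finset ℕ → ℕ → ℕ := fun A => if h : ∃ f, P A f then h.choose else 0
  refine ⟨(Finset.range (n + m)).powerset.image dec, ⟨dec ∅, Finset.mem_image_of_mem _ (by simp)⟩,
    Finset.card_image_le.trans (by simp), fun f hf hm => ?_⟩
  set A := (Finset.range n).image fun k => f k + k
  have hA : ∃ f, P A f := ⟨f, hf, rfl⟩
  refine ⟨dec A, Finset.mem_image_of_mem _ ?_, ?_⟩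
  · rw [Finset.mem_powerset]
    intro i hi
    obtain ⟨k, hk, rfl⟩ := Finset.mem_image.1 hi
    have := hm k (Finset.mem_range.1 hk)
    have := Finset.mem_range.1 hk
    exact Finset.mem_range.2 (by omega)
  · have hd : dec A = hA.choose := dif_pos hA
    obtain ⟨h1, h2⟩ := hA.choose_spec
    rw [← hd] at h1 h2
    have hmono : ∀ φ : ℕ → ℕ, Monotone φ → StrictMono fun k : Fin n => φ k + k :=
      fun φ hφ i j hij => by
        have := hφ (show (i : ℕ) ≤ j from hij.le)
        have : (i : ℕ) < j := hij
        simp only; omega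
    have hr : ∀ φ : ℕ → ℕ, Set.range (fun k : Fin n => φ k + k) =
        ((Finset.range n).image (fun k => φ k + k) : Finset ℕ) := by
      intro φ; ext i
      simp only [Set.mem_range, Finset.coe_image, Set.mem_image, Finset.coe_range, Set.mem_Iio]
      exact ⟨fun ⟨k, hk⟩ => ⟨k, k.2, hk⟩, fun ⟨k, hk, h⟩ => ⟨⟨k, hk⟩, h⟩⟩
    have he : (fun k : Fin n => dec A k + k) = fun k : Fin n => f k + k := by
      rw [← (hmono _ h1).range_inj (hmono _ hf), hr, hr, h2]
    intro k hk
    have := congrFun he ⟨k, hk⟩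
    simpa using this

/-- Binary sequences of length `n` have at most `2 ^ n` representatives. -/
lemma exists_binary_representatives (n : ℕ) :
    ∃ F : Finset (ℕ → ℕ), F.Nonempty ∧ F.card ≤ 2 ^ n ∧
      ∀ f : ℕ → ℕ, (∀ k, f k < 2) → ∃ f' ∈ F, ∀ k < n, f' k = f k := by
  classical
  refine ⟨(Finset.range n).powerset.image fun A k => if k ∈ A then 1 else 0,
    Finset.Nonempty.image ⟨∅, by simp⟩ _,
    Finset.card_image_le.trans (by simp), fun f hf => ⟨_, Finset.mem_image_of_mem _
      (Finset.mem_powerset.2 (Finset.filter_subset (fun k => f k = 1) _)), fun k hk => ?_⟩⟩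
  have := hf k
  by_cases h : f k = 1
  · simp [h, hk]
  · simp [h]; omega

/-! ### Step functions that cover oracles from above. -/

/-- The step function `v ↦ max {β k / n : k < M, τ k / n ≤ v}` (and `0` if no `k` is active). -/
noncomputable def stepBid (n M : ℕ) (c : (ℕ → ℕ) × (ℕ → ℕ)) (v : ℝ) : ℝ :=
  ((Finset.range M).sup fun k => if (c.1 k : ℝ) ≤ n * v then c.2 k else 0 : ℕ) / (n : ℝ)

lemma stepBid_nonneg (n M : ℕ) (c : (ℕ → ℕ) × (ℕ → ℕ)) (v : ℝ) : 0 ≤ stepBid n M c v := by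
  unfold stepBid; positivity

lemma stepBid_congr {n M : ℕ} {c c' : (ℕ → ℕ) × (ℕ → ℕ)} (h1 : ∀ k < M, c.1 k = c'.1 k)
    (h2 : ∀ k < M, c.2 k = c'.2 k) (v : ℝ) : stepBid n M c v = stepBid n M c' v := by
  unfold stepBid
  congr 2
  refine Finset.sup_congr rfl fun k hk => ?_
  rw [h1 k (Finset.mem_range.1 hk), h2 k (Finset.mem_range.1 hk)]

lemma stepBid_le {n M : ℕ} {c : (ℕ → ℕ) × (ℕ → ℕ)} {v x : ℝ} (hn : 0 < n) (hx : 0 ≤ x)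
    (h : ∀ k < M, (c.1 k : ℝ) ≤ n * v → (c.2 k : ℝ) ≤ n * x) : stepBid n M c v ≤ x := by
  have hn' : (0 : ℝ) < n := by exact_mod_cast hn
  unfold stepBid
  rw [div_le_iff₀' hn', ← Nat.le_floor_iff (by positivity)]
  refine Finset.sup_le fun k hk => ?_
  split_ifs with hk'
  · exact Nat.le_floor (h k (Finset.mem_range.1 hk) hk')
  · exact Nat.zero_le _

lemma le_stepBid {n M : ℕ} {c : (ℕ → ℕ) × (ℕ → ℕ)} {v x : ℝ} (hn : 0 < n) {k : ℕ} (hk : k < M)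
    (h1 : (c.1 k : ℝ) ≤ n * v) (h2 : n * x ≤ c.2 k) : x ≤ stepBid n M c v := by
  have hn' : (0 : ℝ) < n := by exact_mod_cast hn
  unfold stepBid
  rw [le_div_iff₀' hn']
  refine h2.trans ?_
  have := Finset.le_sup (f := fun k => if (c.1 k : ℝ) ≤ n * v then c.2 k else 0)
    (Finset.mem_range.2 hk)
  rw [if_pos h1] at this
  exact_mod_cast this

lemma measurable_stepBid (n M : ℕ) (c : (ℕ → ℕ) × (ℕ → ℕ)) : Measurable (stepBid n M c) := by
  unfold stepBid
  refine Measurable.div_const ?_ _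
  refine measurable_from_nat.comp ?_
  induction M with
  | zero => simp
  | succ M ih =>
    simp only [Finset.range_add_one, Finset.sup_insert]
    refine Measurable.sup ?_ ih
    exact Measurable.ite (measurableSet_le measurable_const (measurable_const.mul measurable_id))
      measurable_const measurable_const

/-- `f` approximates the oracle `a` from above up to `ε`, as far as the points of `S` can tell. -/
def Covers (S : Set I) (a : I → I) (ε : ℝ) (f : ℝ → ℝ) : Prop :=
  ∀ v : I, (∀ s ∈ S, s ≤ a v → (s : ℝ) ≤ f v) ∧ f v ≤ a v + ε

section canonical
variable {a : I → I}

lemma oracle_le_add (ha : LipschitzWith 1 a) (hm : Monotone a) {x y : I} {ε : ℝ} (hε : 0 ≤ ε)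
    (h : (x : ℝ) ≤ y + ε) : (a x : ℝ) ≤ a y + ε := by
  rcases le_total x y with hxy | hxy
  · have : (a x : ℝ) ≤ a y := hm hxy
    linarith
  · have h1 := ha.dist_le_mul x y
    rw [Subtype.dist_eq, Subtype.dist_eq, Real.dist_eq, Real.dist_eq] at h1
    have h2 : (y : ℝ) ≤ x := hxy
    rw [abs_of_nonneg (by linarith : (0 : ℝ) ≤ (x : ℝ) - y)] at h1
    have h3 := (abs_le.1 h1).2
    simp only [NNReal.coe_one, one_mul] at h3
    linarith

/-- The left end points of the `n`-cells code a step function above the oracle. -/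
noncomputable def coarseCode (n : ℕ) (a : I → I) : (ℕ → ℕ) × (ℕ → ℕ) :=
  (fun k => k, fun k => ⌈n * (a (Set.projIcc 0 1 zero_le_one ((k : ℝ) / n)) : ℝ)⌉₊ + 1)

lemma coarseCode_monotone (n : ℕ) (hm : Monotone a) : Monotone (coarseCode n a).2 := by
  intro k l hkl
  have h1 : (Set.projIcc (0 : ℝ) 1 zero_le_one ((k : ℝ) / n)) ≤
      Set.projIcc 0 1 zero_le_one ((l : ℝ) / n) := Set.monotone_projIcc _ (by gcongr)
  have h2 : (a (Set.projIcc 0 1 zero_le_one ((k : ℝ) / n)) : ℝ) ≤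
      a (Set.projIcc 0 1 zero_le_one ((l : ℝ) / n)) := hm h1
  simp only [coarseCode]
  gcongr

lemma coarseCode_lt (n k : ℕ) : (coarseCode n a).2 k < n + 2 := by
  have h : ⌈n * (a (Set.projIcc 0 1 zero_le_one ((k : ℝ) / n)) : ℝ)⌉₊ ≤ n := by
    rw [Nat.ceil_le]
    have := (a (Set.projIcc 0 1 zero_le_one ((k : ℝ) / n))).2.2
    nlinarith [(Nat.cast_nonneg n : (0 : ℝ) ≤ n)]
  simp only [coarseCode]; omega

/-- Across a cell the oracle rises by at most `1/n`, which the `+ 1` in `coarseCode` pays for;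
rounding up costs another `1/n`. -/
lemma covers_coarseCode (S : Set I) (ha : LipschitzWith 1 a) (hm : Monotone a) {n : ℕ}
    (hn : 0 < n) : Covers S a (2 / n) (stepBid n n (coarseCode n a)) := by
  have hn' : (0 : ℝ) < n := by exact_mod_cast hn
  have hproj : ∀ k < n, ((Set.projIcc (0 : ℝ) 1 zero_le_one ((k : ℝ) / n) : I) : ℝ) = k / n := by
    intro k hk
    have : (k : ℝ) ≤ n := by exact_mod_cast hk.le
    rw [Set.projIcc_of_mem zero_le_one ⟨by positivity, (div_le_one hn').2 this⟩]
  intro v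
  have hv0 := v.2.1
  have hv1 := v.2.2
  constructor
  · intro s _ hs
    refine le_trans (show (s : ℝ) ≤ a v from hs) ?_
    -- The minimum puts `v = 1` into the last cell.
    set k := min ⌊(n : ℝ) * v⌋₊ (n - 1) with hk
    have hkn : k < n := by omega
    have hk1 : (k : ℝ) ≤ n * v := (Nat.cast_le.2 (min_le_left _ _)).trans
      (Nat.floor_le (by positivity))
    have hk2 : (n : ℝ) * v ≤ k + 1 := by
      rcases le_total ⌊(n : ℝ) * v⌋₊ (n - 1) with h | h
      · rw [hk, min_eq_left h]; exact (Nat.lt_floor_add_one _).le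
      · rw [hk, min_eq_right h]
        have : ((n - 1 : ℕ) : ℝ) + 1 = n := by exact_mod_cast Nat.sub_add_cancel hn
        rw [this]; nlinarith
    refine le_stepBid hn hkn hk1 ?_
    have h1 : (a v : ℝ) ≤ a (Set.projIcc 0 1 zero_le_one ((k : ℝ) / n)) + 1 / n := by
      refine oracle_le_add ha hm (by positivity) ?_
      rw [hproj k hkn, ← add_div, le_div_iff₀ hn']; linarith
    have h2 := Nat.le_ceil (n * (a (Set.projIcc 0 1 zero_le_one ((k : ℝ) / n)) : ℝ))
    have h3 := mul_le_mul_of_nonneg_left h1 hn'.le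
    rw [mul_add, mul_one_div_cancel hn'.ne'] at h3
    simp only [coarseCode]
    push_cast
    linarith
  · have := (a v).2.1
    refine stepBid_le hn (by positivity) fun k hk h => ?_
    have h1 : (a (Set.projIcc 0 1 zero_le_one ((k : ℝ) / n)) : ℝ) ≤ a v := by
      refine hm (show ((Set.projIcc 0 1 zero_le_one ((k : ℝ) / n) : I) : ℝ) ≤ v from ?_)
      rw [hproj k hk, div_le_iff₀ hn']; simpa [coarseCode, mul_comm] using h
    have h2 := (Nat.ceil_lt_add_one (a := n * (a (Set.projIcc 0 1 zero_le_one ((k : ℝ) / n)) : ℝ))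
      (mul_nonneg hn'.le (a _).2.1)).le
    have h3 := mul_le_mul_of_nonneg_left h1 hn'.le
    rw [mul_add, mul_div_cancel₀ _ hn'.ne']
    simp only [coarseCode]
    push_cast
    linarith

lemma exists_least_value (ha : LipschitzWith 1 a) {y : I} (hy : y ≤ a 1) :
    ∃ τ : I, y ≤ a τ ∧ ∀ v, y ≤ a v → τ ≤ v := by
  have hc : IsClosed {v : I | y ≤ a v} := isClosed_le continuous_const ha.continuous
  exact ⟨sInf {v : I | y ≤ a v}, hc.sInf_mem ⟨1, hy⟩, fun v hv => sInf_le hv⟩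

/-- The points `s k` that the oracle ever reaches, with the least values at which it does. -/
lemma exists_thresholds (ha : LipschitzWith 1 a) {s : ℕ → I} (hs : Monotone s) :
    ∃ ρ τ : ℕ → I, Monotone ρ ∧ Monotone τ ∧ (∀ k, ρ k ≤ a (τ k)) ∧
      ∀ k v, Monotone a → s k ≤ a v → ρ k = s k ∧ τ k ≤ v := by
  choose τ h1 h2 using fun k => exists_least_value ha (min_le_right (s k) (a 1))
  have hρ : Monotone fun k => min (s k) (a 1) := fun k l h => min_le_min_right _ (hs h)
  -- A point above `a 1` is never reached. It is capped at `a 1` instead of dropped, which keeps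
  -- both sequences monotone and never forces an overbid.
  refine ⟨fun k => min (s k) (a 1), τ, hρ, fun k l h => h2 k _ ((hρ h).trans (h1 l)), h1,
    fun k v hm hk => ?_⟩
  have h3 : s k ≤ a 1 := hk.trans (hm v.2.2)
  exact ⟨min_eq_left h3, h2 k v ((min_le_left _ _).trans hk)⟩

/-- Thresholds rounded down and bids rounded up to the grid of step `1 / n`. -/
noncomputable def fineCode (n : ℕ) (ρ τ : ℕ → I) : (ℕ → ℕ) × (ℕ → ℕ) :=
  (fun k => ⌊n * (τ k : ℝ)⌋₊, fun k => ⌈n * (ρ k : ℝ)⌉₊)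

/-- An active step has `τ ≤ v + 1/n`, so its bid satisfies `ρ ≤ a τ ≤ a v + 1/n`; rounding `ρ` up
adds at most `1/n` more. -/
lemma covers_fineCode (ha : LipschitzWith 1 a) (hm : Monotone a) {s ρ τ : ℕ → I}
    (h1 : ∀ k, ρ k ≤ a (τ k)) (h2 : ∀ k v, Monotone a → s k ≤ a v → ρ k = s k ∧ τ k ≤ v)
    {n : ℕ} (hn : 0 < n) (K : ℕ) :
    Covers (s '' Set.Iio K) a (2 / n) (stepBid n K (fineCode n ρ τ)) := by
  have hn' : (0 : ℝ) < n := by exact_mod_cast hn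
  intro v
  have hv0 := v.2.1
  constructor
  · rintro _ ⟨k, hk, rfl⟩ hks
    obtain ⟨e1, e2⟩ := h2 k v hm hks
    refine le_stepBid hn hk ?_ ?_
    · exact (Nat.floor_le (mul_nonneg hn'.le (τ k).2.1)).trans
        (mul_le_mul_of_nonneg_left e2 hn'.le)
    · rw [← e1]; exact Nat.le_ceil _
  · have := (a v).2.1
    refine stepBid_le hn (by positivity) fun k hk h => ?_
    have h3 := (Nat.lt_floor_add_one (n * (τ k : ℝ))).le
    simp only [fineCode] at h ⊢
    have h4 : (a (τ k) : ℝ) ≤ a v + 1 / n := by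
      refine oracle_le_add ha hm (by positivity) ?_
      have : (τ k : ℝ) * n ≤ v * n + 1 := by linarith
      rw [← sub_le_iff_le_add', le_div_iff₀ hn']; linarith
    have h5 : (ρ k : ℝ) ≤ a (τ k) := h1 k
    have h6 := (Nat.ceil_lt_add_one (mul_nonneg hn'.le (ρ k).2.1)).le
    have h7 := mul_le_mul_of_nonneg_left (h5.trans h4) hn'.le
    rw [mul_add, mul_one_div_cancel hn'.ne'] at h7
    rw [mul_add, mul_div_cancel₀ _ hn'.ne']
    linarith

/-- Halving the grid step reveals one further binary digit of a threshold; `ceil_two_mul` does the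
same for bids, where the digit is subtracted. Hence two bits per step suffice for each refinement
beyond `j₀`. -/
lemma floor_two_mul (y : ℝ) (hy : 0 ≤ y) : ∃ b < 2, ⌊2 * y⌋₊ = 2 * ⌊y⌋₊ + b := by
  have h1 : 2 * ⌊y⌋₊ ≤ ⌊2 * y⌋₊ := Nat.le_floor (by
    push_cast; linarith [Nat.floor_le hy])
  have h2 : ⌊2 * y⌋₊ < 2 * ⌊y⌋₊ + 2 := (Nat.floor_lt (by linarith)).2 (by
    push_cast; linarith [Nat.lt_floor_add_one y])
  exact ⟨⌊2 * y⌋₊ - 2 * ⌊y⌋₊, by omega, by omega⟩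

lemma ceil_two_mul (y : ℝ) (hy : 0 ≤ y) : ∃ b < 2, ⌈2 * y⌉₊ = 2 * ⌈y⌉₊ - b := by
  have h1 : ⌈2 * y⌉₊ ≤ 2 * ⌈y⌉₊ := Nat.ceil_le.2 (by
    push_cast; linarith [Nat.le_ceil y])
  have h2 : 2 * ⌈y⌉₊ < ⌈2 * y⌉₊ + 2 := by
    have h3 := Nat.ceil_lt_add_one hy
    have h4 := Nat.le_ceil (2 * y)
    have : (2 * ⌈y⌉₊ : ℝ) < ⌈2 * y⌉₊ + 2 := by linarith
    exact_mod_cast this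
  exact ⟨2 * ⌈y⌉₊ - ⌈2 * y⌉₊, by omega, by omega⟩

end canonical

/-! ### The refinement tree of approximations. -/

section track

/-- Number of steps of the level-`j` step function: one per cell on coarse levels, `K` later. -/
def stepCount (j₀ K j : ℕ) : ℕ := if j < j₀ then 2 ^ (j + 1) else K

/-- The step-function code reached after reading the labels `x`: up to level `j₀` labels are codes,
afterwards they hold one more binary digit of each threshold and bid. -/
def code (j₀ : ℕ) (x : ℕ → (ℕ → ℕ) × (ℕ → ℕ)) : ℕ → (ℕ → ℕ) × (ℕ → ℕ)
  | 0 => (0, 0)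
  | j + 1 => if j ≤ j₀ then x j else
      (fun k => 2 * (code j₀ x j).1 k + (x j).1 k, fun k => 2 * (code j₀ x j).2 k - (x j).2 k)

/-- Successive approximations from above; each level lowers the bid by at most `2 ^ (-j)`. -/
noncomputable def track (j₀ K : ℕ) (x : ℕ → (ℕ → ℕ) × (ℕ → ℕ)) : ℕ → ℝ → ℝ
  | 0, _ => 1
  | j + 1, v => min (track j₀ K x j v)
      (max (stepBid (2 ^ (j + 1)) (stepCount j₀ K j) (code j₀ x (j + 1)) v)
        (track j₀ K x j v - (1 / 2) ^ j))

variable {j₀ K : ℕ} {x y : ℕ → (ℕ → ℕ) × (ℕ → ℕ)}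

lemma code_congr {j : ℕ} (h : ∀ i < j, x i = y i) : code j₀ x j = code j₀ y j := by
  induction j with
  | zero => rfl
  | succ j ih =>
    simp only [code, ih fun i hi => h i (by omega), h j (by omega)]

lemma track_congr {j : ℕ} (h : ∀ i < j, x i = y i) : track j₀ K x j = track j₀ K y j := by
  induction j with
  | zero => rfl
  | succ j ih =>
    funext v
    simp only [track, ih fun i hi => h i (by omega), code_congr h]

lemma track_succ_le (j : ℕ) (v : ℝ) : track j₀ K x (j + 1) v ≤ track j₀ K x j v := min_le_left _ _

lemma track_le_succ (j : ℕ) (v : ℝ) :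
    track j₀ K x j v ≤ track j₀ K x (j + 1) v + (1 / 2) ^ j := by
  have : track j₀ K x j v - (1 / 2) ^ j ≤ track j₀ K x (j + 1) v :=
    le_min (by linarith [show (0 : ℝ) ≤ (1 / 2) ^ j by positivity]) (le_max_right _ _)
  linarith

lemma measurable_track (j : ℕ) : Measurable (track j₀ K x j) := by
  induction j with
  | zero => exact measurable_const
  | succ j ih => exact ih.min ((measurable_stepBid _ _ _).max (ih.sub_const _))

/-- The clipping in `track` preserves covering: the previous function and the new step function both
dominate the points of `S` that the oracle reaches, and lowering an error of `2 / 2 ^ j` by `2 ^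
(-j)` leaves exactly `2 / 2 ^ (j + 1)`. -/
lemma covers_track {S : Set I} {a : I → I} {J : ℕ}
    (h : ∀ j < J, Covers S a (2 / (2 ^ (j + 1) : ℕ))
      (stepBid (2 ^ (j + 1)) (stepCount j₀ K j) (code j₀ x (j + 1)))) {j : ℕ} (hj : j ≤ J) :
    Covers S a (2 / 2 ^ j) (track j₀ K x j) := by
  induction j with
  | zero =>
    intro v
    refine ⟨fun s _ _ => s.2.2, ?_⟩
    have := (a v).2.1
    simp [track]; linarith
  | succ j ih =>
    intro v
    obtain ⟨e1, e2⟩ := ih (by omega) v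
    obtain ⟨f1, f2⟩ := h j (by omega) v
    refine ⟨fun s hs hsv => le_min (e1 s hs hsv) (le_max_of_le_left (f1 s hs hsv)), ?_⟩
    refine (min_le_right _ _).trans (max_le ?_ ?_)
    · simpa using f2
    · have : (2 : ℝ) / 2 ^ j - (1 / 2) ^ j = 2 / 2 ^ (j + 1) := by
        rw [pow_succ, div_pow, one_pow]; field_simp; norm_num
      linarith

/-- Label sets of the refinement tree, small on every level, that approximate every oracle. -/
theorem exists_labels (j₀ K : ℕ) : ∃ F : ℕ → Finset ((ℕ → ℕ) × (ℕ → ℕ)),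
    (∀ j, (F j).Nonempty) ∧
    (∀ j < j₀, (F j).card ≤ 2 ^ (2 ^ (j + 1) + (2 ^ (j + 1) + 2))) ∧
    ((F j₀).card ≤ 2 ^ (2 * (K + (2 ^ (j₀ + 1) + 1)))) ∧
    (∀ j > j₀, (F j).card ≤ 2 ^ (2 * K)) ∧
    ∀ (a : I → I) (s : ℕ → I), LipschitzWith 1 a → Monotone a → Monotone s →
      ∃ x : ℕ → (ℕ → ℕ) × (ℕ → ℕ), (∀ j, x j ∈ F j) ∧
        ∀ j, Covers (s '' Set.Iio K) a (2 / 2 ^ j) (track j₀ K x j) := by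
  classical
  choose Mo hMo0 hMo1 hMo2 using exists_monotone_representatives
  choose Bi hBi0 hBi1 hBi2 using exists_binary_representatives
  -- Below `j₀` a label is a whole coarse code; at `j₀` it switches to `K` thresholds with `K` bids;
  -- above, it is one binary digit for each of these.
  let F : ℕ → Finset ((ℕ → ℕ) × (ℕ → ℕ)) := fun j =>
    if j < j₀ then (Mo (2 ^ (j + 1)) (2 ^ (j + 1) + 2)).image fun β => (fun k => k, β)
    else if j = j₀ then Mo K (2 ^ (j + 1) + 1) ×ˢ Mo K (2 ^ (j + 1) + 1) else Bi K ×ˢ Bi K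
  have F1 : ∀ j < j₀, F j = (Mo (2 ^ (j + 1)) (2 ^ (j + 1) + 2)).image fun β => (fun k => k, β) :=
    fun j hj => if_pos hj
  have F2 : F j₀ = Mo K (2 ^ (j₀ + 1) + 1) ×ˢ Mo K (2 ^ (j₀ + 1) + 1) := by simp [F]
  have F3 : ∀ j > j₀, F j = Bi K ×ˢ Bi K := fun j hj => by
    simp only [F]; rw [if_neg (by omega), if_neg (by omega)]
  have tri : ∀ j, j < j₀ ∨ j = j₀ ∨ j > j₀ := fun j => lt_trichotomy j j₀
  refine ⟨F, fun j => ?_, fun j hj => ?_, ?_, fun j hj => ?_, fun a s ha hm hs => ?_⟩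
  · rcases tri j with h | rfl | h
    · rw [F1 j h]; exact (hMo0 _ _).image _
    · rw [F2]; exact (hMo0 _ _).product (hMo0 _ _)
    · rw [F3 j h]; exact (hBi0 _).product (hBi0 _)
  · rw [F1 j hj]; exact Finset.card_image_le.trans (hMo1 _ _)
  · rw [F2, Finset.card_product, two_mul, pow_add _ (K + _)]; exact Nat.mul_le_mul (hMo1 _ _) (hMo1 _ _)
  · rw [F3 j hj, Finset.card_product, two_mul, pow_add]; exact Nat.mul_le_mul (hBi1 _) (hBi1 _)
  obtain ⟨ρ, τ, hρ, hτ, hρτ, hsτ⟩ := exists_thresholds ha hs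
  have hfm : ∀ n : ℕ, Monotone (fineCode n ρ τ).1 ∧ Monotone (fineCode n ρ τ).2 := by
    refine fun n => ⟨fun k l h => Nat.floor_le_floor ?_, fun k l h => Nat.ceil_le_ceil ?_⟩
    · exact mul_le_mul_of_nonneg_left (hτ h) (Nat.cast_nonneg n)
    · exact mul_le_mul_of_nonneg_left (hρ h) (Nat.cast_nonneg n)
  have hfl : ∀ n k : ℕ, (fineCode n ρ τ).1 k < n + 1 ∧ (fineCode n ρ τ).2 k < n + 1 := by
    refine fun n k => ⟨Nat.lt_succ_of_le (Nat.floor_le_of_le ?_),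
      Nat.lt_succ_of_le (Nat.ceil_le.2 ?_)⟩
    · exact mul_le_of_le_one_right (Nat.cast_nonneg n) (τ k).2.2
    · exact mul_le_of_le_one_right (Nat.cast_nonneg n) (ρ k).2.2
  have hlab : ∀ j, ∃ l ∈ F j,
      (j < j₀ → ∀ k < 2 ^ (j + 1), l.1 k = (coarseCode (2 ^ (j + 1)) a).1 k ∧
        l.2 k = (coarseCode (2 ^ (j + 1)) a).2 k) ∧
      (j = j₀ → ∀ k < K, l.1 k = (fineCode (2 ^ (j + 1)) ρ τ).1 k ∧
        l.2 k = (fineCode (2 ^ (j + 1)) ρ τ).2 k) ∧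
      (j > j₀ → ∀ k < K,
        (fineCode (2 ^ (j + 1)) ρ τ).1 k = 2 * (fineCode (2 ^ j) ρ τ).1 k + l.1 k ∧
        (fineCode (2 ^ (j + 1)) ρ τ).2 k = 2 * (fineCode (2 ^ j) ρ τ).2 k - l.2 k) := by
    intro j
    rcases tri j with h | rfl | h
    · obtain ⟨β, hβ, hβ'⟩ := hMo2 (2 ^ (j + 1)) (2 ^ (j + 1) + 2) (coarseCode (2 ^ (j + 1)) a).2
        (coarseCode_monotone _ hm) fun k _ => coarseCode_lt _ k
      exact ⟨(fun k => k, β), by rw [F1 j h]; exact Finset.mem_image_of_mem _ hβ,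
        fun _ k hk => ⟨rfl, hβ' k hk⟩, fun h' => by omega, fun h' => by omega⟩
    · obtain ⟨f, hf, hf'⟩ := hMo2 K (2 ^ (j + 1) + 1) _ (hfm (2 ^ (j + 1))).1
        fun k _ => (hfl _ k).1
      obtain ⟨f2, hf2, hf2'⟩ := hMo2 K (2 ^ (j + 1) + 1) _ (hfm (2 ^ (j + 1))).2
        fun k _ => (hfl _ k).2
      exact ⟨(f, f2), by rw [F2]; exact Finset.mk_mem_product hf hf2, fun h' => by omega,
        fun _ k hk => ⟨hf' k hk, hf2' k hk⟩, fun h' => by omega⟩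
    · choose b hb hb' using fun k => floor_two_mul ((2 ^ j : ℕ) * (τ k : ℝ))
        (mul_nonneg (Nat.cast_nonneg _) (τ k).2.1)
      choose c hc hc' using fun k => ceil_two_mul ((2 ^ j : ℕ) * (ρ k : ℝ))
        (mul_nonneg (Nat.cast_nonneg _) (ρ k).2.1)
      obtain ⟨f, hf, hf'⟩ := hBi2 K b hb
      obtain ⟨f2, hf2, hf2'⟩ := hBi2 K c hc
      refine ⟨(f, f2), by rw [F3 j h]; exact Finset.mk_mem_product hf hf2, fun h' => by omega,
        fun h' => by omega, fun _ k hk => ⟨?_, ?_⟩⟩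
      · simp only [fineCode, hf' k hk, ← hb' k, pow_succ]; push_cast; ring_nf
      · simp only [fineCode, hf2' k hk, ← hc' k, pow_succ]; push_cast; ring_nf
  choose x hx hx1 hx2 hx3 using hlab
  have hcode : ∀ j ≥ j₀, ∀ k < K,
      (code j₀ x (j + 1)).1 k = (fineCode (2 ^ (j + 1)) ρ τ).1 k ∧
      (code j₀ x (j + 1)).2 k = (fineCode (2 ^ (j + 1)) ρ τ).2 k := by
    intro j hj
    induction j, hj using Nat.le_induction with
    | base => intro k hk; simp only [code, le_refl, if_true]; exact hx2 j₀ rfl k hk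
    | succ j hj ih =>
      intro k hk
      obtain ⟨e1, e2⟩ := hx3 (j + 1) (by omega) k hk
      rw [code, if_neg (by omega)]
      simp only [(ih k hk).1, (ih k hk).2]
      exact ⟨e1.symm, e2.symm⟩
  refine ⟨x, hx, fun j => covers_track (J := j) (fun i _ => ?_) le_rfl⟩
  rcases lt_or_ge i j₀ with h | h
  · have e : ∀ v, stepBid (2 ^ (i + 1)) (stepCount j₀ K i) (code j₀ x (i + 1)) v =
        stepBid (2 ^ (i + 1)) (2 ^ (i + 1)) (coarseCode (2 ^ (i + 1)) a) v := by
      intro v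
      rw [stepCount, if_pos h]
      refine stepBid_congr (fun k hk => ?_) (fun k hk => ?_) v
      · rw [code, if_pos h.le]; exact (hx1 i h k hk).1
      · rw [code, if_pos h.le]; exact (hx1 i h k hk).2
    rw [funext e]
    exact covers_coarseCode _ ha hm (by positivity)
  · have e : ∀ v, stepBid (2 ^ (i + 1)) (stepCount j₀ K i) (code j₀ x (i + 1)) v =
        stepBid (2 ^ (i + 1)) K (fineCode (2 ^ (i + 1)) ρ τ) v := by
      intro v
      rw [stepCount, if_neg (by omega)]
      exact stepBid_congr (fun k hk => (hcode i h k hk).1) (fun k hk => (hcode i h k hk).2) v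
    rw [funext e]
    exact covers_fineCode ha hm hρτ hsτ (by positivity) K

end track

/-! ### Rewards, policies built from strategies, and integrability. -/

lemma abs_reward_le (b v m : I) : |reward b v m| ≤ 1 := by
  have := b.2.1; have := b.2.2; have := v.2.1; have := v.2.2
  unfold reward
  split_ifs
  · rw [abs_le]; constructor <;> linarith
  · simp

lemma reward_le_one (b v m : I) : reward b v m ≤ 1 := (abs_le.1 (abs_reward_le b v m)).2

lemma reward_nonneg {b v : I} (m : I) (h : b ≤ v) : 0 ≤ reward b v m := by
  unfold reward
  split_ifs
  · exact sub_nonneg.2 h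
  · exact le_rfl

lemma reward_le_max (b v m : I) : reward b v m ≤ max ((v : ℝ) - m) 0 := by
  unfold reward
  split_ifs with h
  · have : (m : ℝ) ≤ b := h
    exact le_max_of_le_left (by linarith)
  · exact le_max_right _ _

/-- Raising a bid by at most `δ`, without exceeding the value, costs at most `δ`. -/
lemma reward_le_reward_add {b b' v : I} (m : I) {δ : ℝ} (h1 : b' ≤ b) (h2 : (b : ℝ) ≤ b' + δ)
    (hv : b ≤ v) : reward b' v m ≤ reward b v m + δ := by
  have h3 : (b' : ℝ) ≤ b := h1
  have h4 : (b : ℝ) ≤ v := hv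
  unfold reward
  split_ifs with hm hm' hm'
  · linarith
  · exact absurd (hm.trans h1) hm'
  · linarith
  · linarith

lemma measurable_reward : Measurable fun x : I × I × I => reward x.1 x.2.1 x.2.2 := by
  unfold reward
  refine Measurable.ite (measurableSet_le (by fun_prop) (by fun_prop)) ?_ measurable_const
  exact (measurable_subtype_coe.comp (by fun_prop)).sub (measurable_subtype_coe.comp (by fun_prop))

lemma measurable_reward_comp {α : Type*} [MeasurableSpace α] {b v m : α → I} (hb : Measurable b)
    (hv : Measurable v) (hm : Measurable m) : Measurable fun x => reward (b x) (v x) (m x) :=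
  measurable_reward.comp (hb.prodMk (hv.prodMk hm))

variable {T K : ℕ} {q L : ℝ}

section policy
variable {ι : Type*}

/-- The rewards, in the past rounds of a history, of the experts with bidding rules `b`. -/
noncomputable def pastRewards (b : ι → I × I × ℝ≥0 → I) {t : Fin T} (x : History t) (s : ℕ) (i : ι) :
    ℝ :=
  if h : s < t then
    reward (b i (x.1 ⟨⟨s, h.trans t.2⟩, h.le⟩)) (x.1 ⟨⟨s, h.trans t.2⟩, h.le⟩).1
      (x.2 ⟨⟨s, h.trans t.2⟩, h⟩)
  else 0

lemma measurable_pastRewards {b : ι → I × I × ℝ≥0 → I} (hb : ∀ i, Measurable (b i)) (t : Fin T) :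
    Measurable fun x : History t => pastRewards b x := by
  refine measurable_pi_lambda _ fun s => measurable_pi_lambda _ fun i => ?_
  unfold pastRewards
  by_cases h : s < t
  · simp only [h, dif_pos]
    have h1 : Measurable fun x : History t => x.1 ⟨⟨s, h.trans t.2⟩, h.le⟩ :=
      (measurable_pi_apply _).comp measurable_fst
    have h2 : Measurable fun x : History t => x.2 ⟨⟨s, h.trans t.2⟩, h⟩ :=
      (measurable_pi_apply _).comp measurable_snd
    exact measurable_reward_comp ((hb i).comp h1) (measurable_fst.comp h1) h2
  · simp only [h, dif_neg, not_false_eq_true]; exact measurable_const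

variable [Fintype ι]

/-- The policy that draws its bid from the experts' bids according to a strategy. -/
noncomputable def Strategy.toPolicy (A : Strategy ι) (T : ℕ) (b : ι → I × I × ℝ≥0 → I)
    (hb : ∀ i, Measurable (b i)) (hle : ∀ i c, b i c ≤ c.1) : Policy T where
  bid t :=
    { toFun := fun x => ∑ i, ENNReal.ofReal (A.weight t (pastRewards b x) i) •
        Measure.dirac (b i (x.1 ⟨t, Set.self_mem_Iic⟩))
      measurable' := by
        refine Measure.measurable_of_measurable_coe _ fun s hs => ?_
        simp only [Measure.coe_finsetSum, Finset.sum_apply, Measure.smul_apply, smul_eq_mul]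
        refine Finset.measurable_sum _ fun i _ => Measurable.mul ?_ ?_
        · exact ENNReal.measurable_ofReal.comp
            ((A.meas t i).comp (measurable_pastRewards hb t))
        · exact (Measure.measurable_coe hs).comp (Measure.measurable_dirac.comp ((hb i).comp
            ((measurable_pi_apply _).comp measurable_fst))) }
  isMarkov t := ⟨fun x => ⟨by
    show (∑ i, ENNReal.ofReal (A.weight t (pastRewards b x) i) •
        Measure.dirac (b i (x.1 ⟨t, Set.self_mem_Iic⟩)) : Measure I) Set.univ = 1
    simp only [Measure.coe_finsetSum, Finset.sum_apply, Measure.smul_apply, smul_eq_mul,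
      measure_univ, mul_one]
    rw [← ENNReal.ofReal_sum_of_nonneg fun i _ => A.nonneg _ _ _, A.sum_one, ENNReal.ofReal_one]⟩⟩
  bid_le_value t x := by
    show ∀ᵐ y ∂(∑ i, ENNReal.ofReal (A.weight t (pastRewards b x) i) •
        Measure.dirac (b i (x.1 ⟨t, Set.self_mem_Iic⟩)) : Measure I), y ≤ x.value
    rw [ae_iff]
    simp only [Measure.coe_finsetSum, Finset.sum_apply, Measure.smul_apply, smul_eq_mul]
    refine Finset.sum_eq_zero fun i _ => ?_
    have : Measure.dirac (b i (x.1 ⟨t, Set.self_mem_Iic⟩)) {y | ¬ y ≤ x.value} = 0 := by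
      have hs : MeasurableSet {y : I | ¬ y ≤ x.value} :=
        (measurableSet_le measurable_id measurable_const).compl
      rw [Measure.dirac_apply' _ hs]
      exact Set.indicator_of_notMem (fun h : _ ∈ {y : I | ¬ y ≤ x.value} => h (hle i _)) _
    rw [this, mul_zero]

/-- The rewards of the experts on a realization. -/
noncomputable def Environment.expertRewards (E : Environment T K q L) (b : ι → I × I × ℝ≥0 → I)
    (ω : Fin T → I × I) (s : ℕ) (i : ι) : ℝ :=
  if h : s < T then
    reward (b i (E.v ⟨s, h⟩, (ω ⟨s, h⟩).2, E.acc ⟨s, h⟩)) (E.v ⟨s, h⟩) (ω ⟨s, h⟩).1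
  else 0

lemma Environment.gain_toPolicy (E : Environment T K q L) (A : Strategy ι)
    (b : ι → I × I × ℝ≥0 → I) (hb : ∀ i, Measurable (b i)) (hle : ∀ i c, b i c ≤ c.1)
    (ω : Fin T → I × I) :
    E.gain (A.toPolicy T b hb hle) ω =
      ∑ t ∈ Finset.range T, A.gain (E.expertRewards b ω) t := by
  rw [Finset.sum_range]
  refine Finset.sum_congr rfl fun t _ => ?_
  -- The two reward arrays differ from round `t` on, where `pastRewards` is `0` by default;
  -- causality makes this harmless.
  have hw : A.weight t (pastRewards b (E.history ω t)) = A.weight t (E.expertRewards b ω) := by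
    refine A.causal _ _ _ fun s hs => ?_
    funext i
    simp [pastRewards, Environment.expertRewards, hs, hs.trans t.2, Environment.history]
  have hm : ∀ c : I × I × ℝ≥0, StronglyMeasurable fun y : I => reward y (E.v t) (ω t).1 := fun _ =>
    (measurable_reward_comp measurable_id measurable_const measurable_const).stronglyMeasurable
  show ∫ y, reward y (E.v t) (ω t).1 ∂(∑ i, ENNReal.ofReal (A.weight t
    (pastRewards b (E.history ω t)) i) •
      Measure.dirac (b i ((E.history ω t).1 ⟨t, Set.self_mem_Iic⟩)) : Measure I) = _
  rw [integral_finsetSum_measure]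
  · refine Finset.sum_congr rfl fun i _ => ?_
    rw [integral_smul_measure, integral_dirac, hw, ENNReal.toReal_ofReal (A.nonneg _ _ _)]
    simp [Environment.expertRewards, Environment.history]
  · intro i _
    refine Integrable.smul_measure ?_ ENNReal.ofReal_ne_top
    exact integrable_dirac (by simp)

end policy

section integrability

instance (E : Environment T K q L) : IsProbabilityMeasure E.law := E.isProb

/-- A function of the highest competing bids alone is measurable up to a null set, since they take
finitely many values almost surely. -/
lemma Environment.aestronglyMeasurable_of_bids (E : Environment T K q L)
    (G : (Fin T → I) → ℝ) : AEStronglyMeasurable (fun ω => G fun t => (ω t).1) E.law := by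
  obtain ⟨S, -, hS⟩ := E.sparse
  have hm : Measurable fun ω : Fin T → I × I => fun t => (ω t).1 :=
    measurable_pi_lambda _ fun t => measurable_fst.comp (measurable_pi_apply t)
  refine ⟨fun ω => ∑ p ∈ Fintype.piFinset fun _ : Fin T => S,
    ({ω : Fin T → I × I | (fun t => (ω t).1) = p}).indicator (fun _ => G p) ω, ?_, ?_⟩
  · refine Finset.stronglyMeasurable_fun_sum _ fun p _ => ?_
    exact stronglyMeasurable_const.indicator (hm (measurableSet_singleton p))
  · filter_upwards [hS] with ω hω
    rw [Finset.sum_eq_single (fun t => (ω t).1)]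
    · simp
    · intro p _ hp
      simp [hp.symm]
    · intro h
      exact absurd (Fintype.mem_piFinset.2 hω) h

/-- The oracle that always bids `0`. -/
def zeroOracle : Oracle := ⟨fun _ => 0, LipschitzWith.const' 0 |>.weaken zero_le_one,
  monotone_const⟩

instance : Nonempty Oracle := ⟨zeroOracle⟩

lemma sum_reward_le (E : Environment T K q L) (ω : Fin T → I × I) (a : Oracle) :
    ∑ t, reward (a.1 (E.v t)) (E.v t) (ω t).1 ≤ T := by
  calc _ ≤ ∑ _t : Fin T, (1 : ℝ) := Finset.sum_le_sum fun t _ => reward_le_one _ _ _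
    _ = T := by simp

lemma Environment.le_best (E : Environment T K q L) (ω : Fin T → I × I) (a : Oracle) :
    ∑ t, reward (a.1 (E.v t)) (E.v t) (ω t).1 ≤ E.best ω :=
  le_ciSup (f := fun a : Oracle => ∑ t, reward (a.1 (E.v t)) (E.v t) (ω t).1)
    ⟨T, by rintro _ ⟨a, rfl⟩; exact sum_reward_le E ω a⟩ a

lemma Environment.best_le (E : Environment T K q L) (ω : Fin T → I × I) {c : ℝ}
    (h : ∀ a : Oracle, ∑ t, reward (a.1 (E.v t)) (E.v t) (ω t).1 ≤ c) : E.best ω ≤ c :=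
  ciSup_le h

/-- The supremum runs over uncountably many oracles, but it depends on the competing bids alone, and
almost surely these take finitely many values. -/
lemma Environment.integrable_best (E : Environment T K q L) : Integrable E.best E.law := by
  refine Integrable.of_bound (C := T) (E.aestronglyMeasurable_of_bids fun m =>
    ⨆ a : Oracle, ∑ t, reward (a.1 (E.v t)) (E.v t) (m t)) (ae_of_all _ fun ω => ?_)
  rw [Real.norm_eq_abs, abs_le]
  refine ⟨?_, E.best_le ω fun a => sum_reward_le E ω a⟩
  refine le_trans ?_ (E.le_best ω zeroOracle)
  have : 0 ≤ ∑ t, reward (zeroOracle.1 (E.v t)) (E.v t) (ω t).1 :=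
    Finset.sum_nonneg fun t _ => reward_nonneg _ (E.v t).2.1
  have hT : (0 : ℝ) ≤ T := Nat.cast_nonneg T
  linarith

lemma Environment.measurable_history (E : Environment T K q L) (t : Fin T) :
    Measurable fun ω => E.history ω t := by
  refine Measurable.prodMk ?_ ?_
  · refine measurable_pi_lambda _ fun s => measurable_const.prodMk (Measurable.prodMk ?_
      measurable_const)
    exact measurable_snd.comp (measurable_pi_apply _)
  · exact measurable_pi_lambda _ fun s => measurable_fst.comp (measurable_pi_apply _)

lemma Environment.measurable_roundGain (E : Environment T K q L) (π : Policy T) (t : Fin T) :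
    Measurable fun ω : Fin T → I × I =>
      ∫ b, reward b (E.v t) (ω t).1 ∂(π.bid t (E.history ω t)) := by
  have := π.isMarkov t
  have h := StronglyMeasurable.integral_kernel_prod_right'
    (κ := (π.bid t).comap (fun ω => E.history ω t) (E.measurable_history t))
    (f := fun p : (Fin T → I × I) × I => reward p.2 (E.v t) (p.1 t).1)
    (measurable_reward_comp measurable_snd measurable_const
      (measurable_fst.comp ((measurable_pi_apply t).comp measurable_fst))).stronglyMeasurable
  exact h.measurable

lemma Environment.measurable_gain (E : Environment T K q L) (π : Policy T) :
    Measurable (E.gain π) :=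
  Finset.measurable_sum _ fun t _ => E.measurable_roundGain π t

lemma abs_integral_reward_le (π : Policy T) {t : Fin T} (x : History t) (v m : I) :
    |∫ b, reward b v m ∂(π.bid t x)| ≤ 1 := by
  have := π.isMarkov t
  have h := norm_integral_le_of_norm_le_const (μ := π.bid t x) (f := fun b => reward b v m) (C := 1)
    (ae_of_all _ fun b => abs_reward_le b v m)
  simpa using h

lemma Environment.integrable_gain (E : Environment T K q L) (π : Policy T) :
    Integrable (E.gain π) E.law := by
  refine Integrable.of_bound (C := T) (E.measurable_gain π).aestronglyMeasurable
    (ae_of_all _ fun ω => ?_)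
  refine (norm_sum_le _ _).trans ?_
  calc _ ≤ ∑ _t : Fin T, (1 : ℝ) :=
        Finset.sum_le_sum fun t _ => abs_integral_reward_le π _ _ _
    _ = T := by simp

lemma regret_eq (π : Policy T) (E : Environment T K q L) :
    regret π E = ∫ ω, E.best ω ∂E.law - ∫ ω, E.gain π ω ∂E.law :=
  integral_sub E.integrable_best (E.integrable_gain π)

lemma regret_le_integral (π : Policy T) (E : Environment T K q L) {F : (Fin T → I × I) → ℝ}
    (hF : Integrable F E.law) (h : ∀ᵐ ω ∂E.law, E.best ω - E.gain π ω ≤ F ω) :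
    regret π E ≤ ∫ ω, F ω ∂E.law :=
  integral_mono_ae (E.integrable_best.sub (E.integrable_gain π)) hF h

lemma minimaxRegret_le {c : ℝ} (π : Policy T) (h : ∀ E : Environment T K q L, regret π E ≤ c) :
    minimaxRegret T K q L ≤ (c : EReal) :=
  iInf_le_of_le π (iSup_le fun E => EReal.coe_le_coe_iff.2 (h E))

lemma le_minimaxRegret {c : ℝ} (E : Environment T K q L) (h : ∀ π : Policy T, c ≤ regret π E) :
    (c : EReal) ≤ minimaxRegret T K q L :=
  le_iInf fun π => le_iSup_of_le E (EReal.coe_le_coe_iff.2 (h π))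

end integrability

/-! ### From covers to bids. -/

/-- The admissible bid closest to `f v`. -/
noncomputable def bidOf (f : ℝ → ℝ) (v : I) : I := min v (Set.projIcc 0 1 zero_le_one (f v))

lemma bidOf_le (f : ℝ → ℝ) (v : I) : bidOf f v ≤ v := min_le_left _ _

lemma measurable_bidOf {f : ℝ → ℝ} (hf : Measurable f) : Measurable (bidOf f) :=
  measurable_id.min (continuous_projIcc.measurable.comp (hf.comp measurable_subtype_coe))

lemma bidOf_mono {f f' : ℝ → ℝ} {v : I} (h : f' v ≤ f v) : bidOf f' v ≤ bidOf f v :=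
  min_le_min_left _ (Set.monotone_projIcc _ h)

lemma bidOf_le_add {f f' : ℝ → ℝ} {v : I} {δ : ℝ} (hδ : 0 ≤ δ) (h : f v ≤ f' v + δ) :
    (bidOf f v : ℝ) ≤ bidOf f' v + δ := by
  have hmin : ∀ x y : I, ((min x y : I) : ℝ) = min (x : ℝ) y := fun x y => by
    rcases le_total x y with h | h
    · rw [min_eq_left h, min_eq_left (show (x : ℝ) ≤ y from h)]
    · rw [min_eq_right h, min_eq_right (show (y : ℝ) ≤ x from h)]
  simp only [bidOf, hmin, Set.coe_projIcc]
  rw [← min_add_add_right]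
  refine min_le_min (by linarith) ?_
  rw [← max_add_add_right, ← min_add_add_right]
  exact max_le_max (by linarith) (min_le_min (by linarith) h)

/-- If the oracle wins at a bid not above `v`, the covering bid is also at least `m`, hence wins,
paying at most `ε` more. An oracle bidding above `v` earns nothing positive, so truncation at `v` is
free. -/
lemma reward_le_of_covers {S : Set I} {a : I → I} {ε : ℝ} {f : ℝ → ℝ} (hε : 0 ≤ ε)
    (h : Covers S a ε f) {m : I} (hm : m ∈ S) (v : I) :
    reward (a v) v m ≤ reward (bidOf f v) v m + ε := by
  have hr := reward_nonneg m (bidOf_le f v)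
  by_cases hma : m ≤ a v
  · obtain ⟨h1, h2⟩ := h v
    have h3 := h1 m hm hma
    rcases le_total v (a v) with hv | hv
    · have : (v : ℝ) ≤ a v := hv
      have : reward (a v) v m ≤ 0 := by
        rw [reward, if_pos hma]; linarith
      linarith
    · have h4 : m ≤ bidOf f v := by
        refine le_min (hma.trans hv) (show (m : ℝ) ≤ _ from ?_)
        rw [Set.coe_projIcc]
        exact le_max_of_le_right (le_min m.2.2 h3)
      have h5 : (bidOf f v : ℝ) ≤ f v := by
        refine (show (bidOf f v : ℝ) ≤ (Set.projIcc 0 1 zero_le_one (f v) : I) from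
          min_le_right v _).trans ?_
        rw [Set.coe_projIcc]
        exact max_le (m.2.1.trans h3) (min_le_right _ _)
      rw [reward, reward, if_pos hma, if_pos h4]
      linarith
  · rw [reward, if_neg hma]
    linarith

lemma exists_monotone_enumeration (S : Finset I) (hS : S.card ≤ K) :
    ∃ s : ℕ → I, Monotone s ∧ (S : Set I) ⊆ s '' Set.Iio K := by
  rcases Nat.eq_zero_or_pos S.card with h0 | h0
  · exact ⟨fun _ => 0, monotone_const, by simp [Finset.card_eq_zero.1 h0]⟩
  -- The enumeration is prolonged by repeating the largest point.
  · refine ⟨fun k => S.orderEmbOfFin rfl ⟨min k (S.card - 1), by omega⟩, fun k l h => ?_,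
      fun m hm => ?_⟩
    · exact (S.orderEmbOfFin rfl).monotone (Fin.mk_le_mk.2 (min_le_min_right _ h))
    · have : m ∈ Set.range (S.orderEmbOfFin rfl) := by
        rw [Finset.range_orderEmbOfFin]; exact hm
      obtain ⟨i, rfl⟩ := this
      have hi := i.2
      refine ⟨i, show (i : ℕ) < K by omega, ?_⟩
      have e : (⟨min (i : ℕ) (S.card - 1), by omega⟩ : Fin S.card) = i := Fin.ext (by simp; omega)
      simp only [e]

/-! ### Bidding from the hints alone. -/

section hint

/-- Safety margin added to a hint of accuracy `σ`. -/
noncomputable def margin (T : ℕ) (q : ℝ) (s : ℝ≥0) : ℝ := ((s : ℝ) + 1 / T) ^ (q / (q + 1))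

/-- Bid the hint plus its safety margin. -/
noncomputable def hintBid (T : ℕ) (q : ℝ) (c : I × I × ℝ≥0) : I :=
  min c.1 (Set.projIcc 0 1 zero_le_one ((c.2.1 : ℝ) + margin T q c.2.2))

lemma hintBid_le (T : ℕ) (q : ℝ) (c : I × I × ℝ≥0) : hintBid T q c ≤ c.1 := min_le_left _ _

lemma measurable_hintBid (T : ℕ) (q : ℝ) : Measurable (hintBid T q) := by
  refine measurable_fst.min (continuous_projIcc.measurable.comp ?_)
  unfold margin
  fun_prop

lemma margin_pos (hT : 0 < T) (s : ℝ≥0) : 0 < margin T q s := by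
  have : (0 : ℝ) < T := by exact_mod_cast hT
  unfold margin
  positivity

/-- This is Markov's inequality before taking expectations: a hint within the margin wins whenever
`m ≤ v` and overpays at most twice the margin; otherwise the loss is at most `1`, below the ratio of
`q`-th powers. -/
lemma hintBid_loss_le (hT : 0 < T) (hq : 1 ≤ q) (v h m : I) (s : ℝ≥0) :
    max ((v : ℝ) - m) 0 - reward (hintBid T q (v, h, s)) v m ≤
      2 * margin T q s + |(h : ℝ) - m| ^ q / margin T q s ^ q := by
  have hd := margin_pos (q := q) hT s
  set d := margin T q s
  set b := hintBid T q (v, h, s) with hb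
  have hbv : b ≤ v := min_le_left _ _
  have hr := reward_nonneg m hbv
  have hv := v.2; have hm := m.2; have hh := h.2
  rcases le_or_gt |(h : ℝ) - m| d with hc | hc
  · have hpow : 0 ≤ |(h : ℝ) - m| ^ q / d ^ q := by positivity
    have h1 := (abs_le.1 hc).1
    have h2 := (abs_le.1 hc).2
    rcases le_or_gt m v with hmv | hmv
    · have hmv' : (m : ℝ) ≤ v := hmv
      have hmb : m ≤ b := by
        refine le_min hmv (show (m : ℝ) ≤ _ from ?_)
        rw [Set.coe_projIcc]
        exact le_max_of_le_right (le_min hm.2 (by show (m : ℝ) ≤ h + d; linarith))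
      have hbd : (b : ℝ) ≤ h + d := by
        refine (show (b : ℝ) ≤ (Set.projIcc 0 1 zero_le_one ((h : ℝ) + d) : I) from
          min_le_right v _).trans ?_
        rw [Set.coe_projIcc]
        exact max_le (by linarith [hh.1]) (min_le_right _ _)
      rw [reward, if_pos hmb, max_eq_left (by linarith)]
      linarith
    · have : (v : ℝ) < m := hmv
      rw [max_eq_right (by linarith)]
      linarith
  · have h1 : 1 ≤ |(h : ℝ) - m| ^ q / d ^ q := by
      rw [one_le_div (by positivity)]
      exact Real.rpow_le_rpow hd.le hc.le (by linarith)
    have h2 : max ((v : ℝ) - m) 0 ≤ 1 := max_le (by linarith [hv.2, hm.1]) zero_le_one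
    linarith

/-- Power mean with exponent `p = (q+1)/q`, for which `margin ^ p = σ + 1/T`. The summands `1/T`,
which keep margins positive, add up to `1 ≤ L`, and this only doubles the bound. -/
lemma sum_margin_le (E : Environment T K q L) (hT : 0 < T) (hq : 1 ≤ q) (hL : 1 ≤ L) :
    ∑ t, margin T q (E.acc t) ≤ 2 * hintRate T q L := by
  have hT' : (0 : ℝ) < T := by exact_mod_cast hT
  set p := (q + 1) / q with hp
  have hp1 : 1 ≤ p := by rw [hp, one_le_div (by linarith)]; linarith
  have hpi : q / (q + 1) = 1 / p := by rw [hp, one_div_div]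
  have hnn : ∀ t, 0 ≤ margin T q (E.acc t) := fun t => (margin_pos hT _).le
  have h1 := Real.rpow_sum_le_const_mul_sum_rpow_of_nonneg (f := fun t => margin T q (E.acc t))
    Finset.univ hp1 (fun t _ => hnn t)
  have h2 : ∀ t, margin T q (E.acc t) ^ p = E.acc t + 1 / T := by
    intro t
    rw [margin, ← Real.rpow_mul (by positivity), hpi, one_div_mul_cancel (by linarith),
      Real.rpow_one]
  have h3 : ∑ t, margin T q (E.acc t) ^ p = L + 1 := by
    simp only [h2, Finset.sum_add_distrib, E.total]
    simp [hT'.ne']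
  rw [h3] at h1
  simp only [Finset.card_univ, Fintype.card_fin] at h1
  have h4 : ∑ t, margin T q (E.acc t) ≤ ((T : ℝ) ^ (p - 1) * (L + 1)) ^ (1 / p) := by
    rw [one_div, Real.le_rpow_inv_iff_of_pos (Finset.sum_nonneg fun t _ => hnn t) (by positivity)
      (by linarith)]
    exact h1
  refine h4.trans ?_
  have h5 : ((T : ℝ) ^ (p - 1)) ^ (1 / p) = (T : ℝ) ^ (1 / (q + 1)) := by
    rw [← Real.rpow_mul hT'.le]
    congr 1
    rw [hp]; field_simp; ring
  have h6 : (L + 1) ^ (1 / p) ≤ 2 * L ^ (1 / p) := by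
    calc (L + 1) ^ (1 / p) ≤ (2 * L) ^ (1 / p) :=
          Real.rpow_le_rpow (by linarith) (by linarith) (by positivity)
      _ = 2 ^ (1 / p) * L ^ (1 / p) := Real.mul_rpow (by norm_num) (by linarith)
      _ ≤ 2 * L ^ (1 / p) := by
          refine mul_le_mul_of_nonneg_right ?_ (by positivity)
          calc (2 : ℝ) ^ (1 / p) ≤ 2 ^ (1 : ℝ) :=
                Real.rpow_le_rpow_of_exponent_le (by norm_num) ((div_le_one (by linarith)).2 hp1)
            _ = 2 := Real.rpow_one 2
  rw [Real.mul_rpow (by positivity) (by linarith), h5, hintRate, hpi]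
  have : 0 ≤ (T : ℝ) ^ (1 / (q + 1)) := by positivity
  nlinarith [mul_le_mul_of_nonneg_left h6 this]

/-- Pathwise bound on the total loss of the hint bids. -/
noncomputable def Environment.hintLoss (E : Environment T K q L) (ω : Fin T → I × I) : ℝ :=
  ∑ t, (2 * margin T q (E.acc t) +
    |((ω t).2 : ℝ) - ((ω t).1 : ℝ)| ^ q / margin T q (E.acc t) ^ q)

lemma Environment.integrable_hint (E : Environment T K q L) (hq : 1 ≤ q) (t : Fin T) :
    Integrable (fun ω => |((ω t).2 : ℝ) - ((ω t).1 : ℝ)| ^ q) E.law := by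
  refine Integrable.of_bound (C := 1) (Measurable.aestronglyMeasurable (by fun_prop))
    (ae_of_all _ fun ω => ?_)
  have h1 := (ω t).1.2; have h2 := (ω t).2.2
  rw [Real.norm_eq_abs, abs_of_nonneg (by positivity)]
  refine Real.rpow_le_one (abs_nonneg _) (abs_le.2 ⟨?_, ?_⟩) (by linarith)
  · linarith [h1.2, h2.1]
  · linarith [h1.1, h2.2]

lemma Environment.integrable_hintLoss (E : Environment T K q L) (hq : 1 ≤ q) :
    Integrable E.hintLoss E.law :=
  integrable_finsetSum _ fun t _ =>
    (integrable_const _).add ((E.integrable_hint hq t).div_const _)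

lemma Environment.integral_hintLoss_le (E : Environment T K q L) (hT : 0 < T) (hq : 1 ≤ q)
    (hL : 1 ≤ L) : ∫ ω, E.hintLoss ω ∂E.law ≤ 6 * hintRate T q L := by
  have hT' : (0 : ℝ) < T := by exact_mod_cast hT
  unfold Environment.hintLoss
  have hi : ∀ t, Integrable (fun ω : Fin T → I × I => 2 * margin T q (E.acc t) +
      |((ω t).2 : ℝ) - ((ω t).1 : ℝ)| ^ q / margin T q (E.acc t) ^ q) E.law := fun t =>
    (integrable_const _).add ((E.integrable_hint hq t).div_const _)
  rw [integral_finsetSum _ fun t _ => hi t]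
  have h1 : ∀ t, ∫ ω, (2 * margin T q (E.acc t) +
      |((ω t).2 : ℝ) - ((ω t).1 : ℝ)| ^ q / margin T q (E.acc t) ^ q) ∂E.law ≤
      3 * margin T q (E.acc t) := by
    intro t
    have hd := margin_pos (q := q) hT (E.acc t)
    rw [integral_add (integrable_const _) ((E.integrable_hint hq t).div_const _),
      integral_div, integral_const]
    have h2 : ∫ ω, |((ω t).2 : ℝ) - ((ω t).1 : ℝ)| ^ q ∂E.law ≤ (E.acc t + 1 / T : ℝ) ^ q :=
      (E.hint t).trans (Real.rpow_le_rpow (by positivity) (by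
        have : (0 : ℝ) ≤ 1 / T := by positivity
        linarith) (by linarith))
    -- The balance that defines the margin: `d ^ (q+1) = (σ + 1/T) ^ q`, so the failure term is at
    -- most one more `d` in expectation.
    have h3 : (E.acc t + 1 / T : ℝ) ^ q = margin T q (E.acc t) * margin T q (E.acc t) ^ q := by
      have hpos : (0 : ℝ) < E.acc t + 1 / T := by positivity
      rw [margin, ← Real.rpow_mul hpos.le, ← Real.rpow_add hpos]
      congr 1; field_simp; ring
    have h4 : (∫ ω, |((ω t).2 : ℝ) - ((ω t).1 : ℝ)| ^ q ∂E.law) / margin T q (E.acc t) ^ q ≤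
        margin T q (E.acc t) := by
      rw [div_le_iff₀ (by positivity), ← h3]; exact h2
    simp only [probReal_univ, one_smul]
    linarith
  refine (Finset.sum_le_sum fun t _ => h1 t).trans ?_
  rw [← Finset.mul_sum]
  linarith [sum_margin_le E hT hq hL]

lemma Environment.sum_loss_le_hintLoss (E : Environment T K q L) (hT : 0 < T) (hq : 1 ≤ q)
    (ω : Fin T → I × I) :
    ∑ t, (max ((E.v t : ℝ) - (ω t).1) 0 -
      reward (hintBid T q (E.v t, (ω t).2, E.acc t)) (E.v t) (ω t).1) ≤ E.hintLoss ω :=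
  Finset.sum_le_sum fun _ _ => hintBid_loss_le hT hq _ _ _ _

lemma Environment.sum_expertRewards {ι : Type*} (E : Environment T K q L)
    (b : ι → I × I × ℝ≥0 → I) (ω : Fin T → I × I) (i : ι) :
    ∑ t ∈ Finset.range T, E.expertRewards b ω t i =
      ∑ t, reward (b i (E.v t, (ω t).2, E.acc t)) (E.v t) (ω t).1 := by
  rw [Finset.sum_range]
  exact Finset.sum_congr rfl fun t _ => by simp [Environment.expertRewards]

lemma Environment.expertRewards_nonneg {ι : Type*} (E : Environment T K q L)
    {b : ι → I × I × ℝ≥0 → I} (hle : ∀ i c, b i c ≤ c.1) (ω : Fin T → I × I) (t : ℕ) (i : ι) :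
    0 ≤ E.expertRewards b ω t i := by
  unfold Environment.expertRewards
  split_ifs
  · exact reward_nonneg _ (hle i _)
  · exact le_rfl

lemma Environment.expertRewards_le_one {ι : Type*} (E : Environment T K q L)
    (b : ι → I × I × ℝ≥0 → I) (ω : Fin T → I × I) (t : ℕ) (i : ι) :
    E.expertRewards b ω t i ≤ 1 := by
  unfold Environment.expertRewards
  split_ifs
  · exact reward_le_one _ _ _
  · exact zero_le_one

theorem minimaxRegret_le_hintRate (hT : 0 < T) (hq : 1 ≤ q) (hL : 1 ≤ L) :
    minimaxRegret T K q L ≤ ((6 * hintRate T q L : ℝ) : EReal) := by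
  refine minimaxRegret_le ((Strategy.const ()).toPolicy T (fun _ => hintBid T q)
    (fun _ => measurable_hintBid T q) fun _ => hintBid_le T q) fun E => ?_
  refine (regret_le_integral _ E (E.integrable_hintLoss hq) (ae_of_all _ fun ω => ?_)).trans
    (E.integral_hintLoss_le hT hq hL)
  rw [E.gain_toPolicy]
  simp only [Strategy.gain_const]
  rw [E.sum_expertRewards (fun _ => hintBid T q)]
  have h1 := E.sum_loss_le_hintLoss hT hq ω
  rw [Finset.sum_sub_distrib] at h1
  have h2 : E.best ω ≤ ∑ t, max ((E.v t : ℝ) - (ω t).1) 0 :=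
    E.best_le ω fun a => Finset.sum_le_sum fun t _ => reward_le_max _ _ _
  linarith

end hint

lemma hintRate_pos (hT : 0 < T) (hL : 1 ≤ L) : 0 < hintRate T q L := by
  have : (0 : ℝ) < T := by exact_mod_cast hT
  have : 0 < L := by linarith
  unfold hintRate
  positivity

lemma one_le_hintRate (hT : 0 < T) (hq : 1 ≤ q) (hL : 1 ≤ L) : 1 ≤ hintRate T q L := by
  have : (1 : ℝ) ≤ T := by exact_mod_cast hT
  exact one_le_mul_of_one_le_of_one_le (Real.one_le_rpow this (by positivity))
    (Real.one_le_rpow hL (by positivity))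

/-! ### Exponential weights over step functions and the hint bid. -/

section sparse

/-- The step functions with `K` steps on the grid of step `1 / T`. -/
noncomputable def gridCode (c : Fin K → Fin (T + 1) × Fin (T + 1)) : (ℕ → ℕ) × (ℕ → ℕ) :=
  (fun k => if h : k < K then (c ⟨k, h⟩).1 else 0, fun k => if h : k < K then (c ⟨k, h⟩).2 else 0)

/-- The hint bid (`none`) and the grid step functions (`some`). -/
noncomputable def sparseBid (T K : ℕ) (q : ℝ) :
    Option (Fin K → Fin (T + 1) × Fin (T + 1)) → I × I × ℝ≥0 → I
  | none => hintBid T q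
  | some c => fun x => bidOf (stepBid T K (gridCode c)) x.1

lemma exists_gridCode_covers {S : Finset I} (hS : S.card ≤ K) (hT : 0 < T) (a : Oracle) :
    ∃ c : Fin K → Fin (T + 1) × Fin (T + 1), Covers S a.1 (2 / T) (stepBid T K (gridCode c)) := by
  obtain ⟨s, hs, hSs⟩ := exists_monotone_enumeration S hS
  obtain ⟨ρ, τ, -, -, hρτ, hsτ⟩ := exists_thresholds a.2.1 hs
  have h1 : ∀ k, (fineCode T ρ τ).1 k < T + 1 := fun k =>
    Nat.lt_succ_of_le (Nat.floor_le_of_le (mul_le_of_le_one_right (Nat.cast_nonneg T) (τ k).2.2))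
  have h2 : ∀ k, (fineCode T ρ τ).2 k < T + 1 := fun k =>
    Nat.lt_succ_of_le (Nat.ceil_le.2 (mul_le_of_le_one_right (Nat.cast_nonneg T) (ρ k).2.2))
  refine ⟨fun k => (⟨_, h1 k⟩, ⟨_, h2 k⟩), fun v => ?_⟩
  rw [stepBid_congr (c' := fineCode T ρ τ) (fun k hk => by simp [gridCode, hk])
    (fun k hk => by simp [gridCode, hk])]
  obtain ⟨e1, e2⟩ := covers_fineCode a.2.1 a.2.2 hρτ hsτ hT K v
  exact ⟨fun m hm => e1 m (hSs hm), e2⟩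

lemma log_card_sparse_le (hT : 2 ≤ T) (hK : 1 ≤ K) :
    Real.log (Fintype.card (Option (Fin K → Fin (T + 1) × Fin (T + 1)))) ≤
      6 * K * Real.log T := by
  have h1 : Fintype.card (Option (Fin K → Fin (T + 1) × Fin (T + 1))) ≤ T ^ (6 * K) := by
    simp only [Fintype.card_option, Fintype.card_fun, Fintype.card_prod, Fintype.card_fin]
    have h2 : T + 1 ≤ T ^ 2 := by nlinarith
    have h4 : (T + 1) * (T + 1) ≤ T ^ 4 := by
      calc _ ≤ T ^ 2 * T ^ 2 := Nat.mul_le_mul h2 h2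
        _ = T ^ 4 := by ring
    have h3 : ((T + 1) * (T + 1)) ^ K ≤ T ^ (4 * K) := by
      rw [pow_mul]; exact Nat.pow_le_pow_left h4 K
    have h5 : T ^ (6 * K) = T ^ (4 * K) * T ^ (2 * K) := by rw [← pow_add]; ring_nf
    have h6 : 2 ≤ T ^ (2 * K) := by
      calc 2 ≤ T := hT
        _ = T ^ 1 := (pow_one T).symm
        _ ≤ T ^ (2 * K) := Nat.pow_le_pow_right (by omega) (by omega)
    have h7 : 1 ≤ T ^ (4 * K) := Nat.one_le_pow _ _ (by omega)
    rw [h5]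
    nlinarith
  calc _ ≤ Real.log ((T : ℝ) ^ (6 * K)) :=
        Real.log_le_log (by exact_mod_cast Fintype.card_pos) (by exact_mod_cast h1)
    _ = 6 * K * Real.log T := by rw [Real.log_pow]; push_cast; ring

theorem minimaxRegret_le_sparse (hT : 2 ≤ T) (hK : 1 ≤ K) (hq : 1 ≤ q) (hL : 1 ≤ L) :
    minimaxRegret T K q L ≤
      ((40 * √(Real.log (T : ℝ) * hintRate T q L * (K : ℝ)) : ℝ) : EReal) := by
  have hT0 : 0 < T := by omega
  have hT' : (0 : ℝ) < T := by exact_mod_cast hT0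
  have hK' : (1 : ℝ) ≤ K := by exact_mod_cast hK
  have hlog : 1 / 2 ≤ Real.log T := by
    have : Real.log 2 ≤ Real.log T := Real.log_le_log (by norm_num) (by exact_mod_cast hT)
    linarith [Real.log_two_gt_d9]
  have hH := one_le_hintRate hT0 hq hL
  set H := hintRate T q L
  set R := 6 * K * Real.log T with hR
  have hR3 : 3 ≤ R := by nlinarith
  have hRH : √(R * H) ≤ 3 * √(Real.log T * H * K) := by
    have : R * H = 6 * (Real.log T * H * K) := by rw [hR]; ring
    rw [this, Real.sqrt_mul (by norm_num)]
    have h6 : √6 ≤ 3 := Real.sqrt_le_iff.2 ⟨by norm_num, by norm_num⟩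
    exact mul_le_mul_of_nonneg_right h6 (Real.sqrt_nonneg _)
  -- For `H < R` hints alone suffice, since then `H ≤ √(RH)`; otherwise `R / H ≤ 1` makes the
  -- learning rate admissible.
  rcases lt_or_ge H R with hc | hc
  · refine (minimaxRegret_le_hintRate hT0 hq hL).trans (EReal.coe_le_coe_iff.2 ?_)
    have h1 : H ≤ √(R * H) := Real.le_sqrt_of_sq_le (by nlinarith)
    have := Real.sqrt_nonneg (Real.log T * H * K)
    change 6 * H ≤ _
    linarith
  set η := √(R / H) / 3 with hη
  have hη0 : 0 < η := by positivity
  have hη3 : η ≤ 1 / 3 := by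
    have : √(R / H) ≤ 1 := Real.sqrt_le_one.2 ((div_le_one (by linarith)).2 hc)
    linarith
  have hle : ∀ i c, sparseBid T K q i c ≤ c.1 := by
    rintro (_ | i) c
    · exact hintBid_le T q c
    · exact bidOf_le _ _
  have hmeas : ∀ i, Measurable (sparseBid T K q i) := by
    rintro (_ | i)
    · exact measurable_hintBid T q
    · exact (measurable_bidOf (measurable_stepBid _ _ _)).comp measurable_fst
  refine minimaxRegret_le ((Strategy.hedge η (fun i => Strategy.const i)).toPolicy T
    (sparseBid T K q) hmeas hle) fun E => ?_
  obtain ⟨S, hSK, hS⟩ := E.sparse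
  have hint : Integrable (fun ω => 3 * η * E.hintLoss ω + (2 * R / η + 2)) E.law :=
    ((E.integrable_hintLoss hq).const_mul _).add (integrable_const _)
  refine (regret_le_integral _ E hint ?_).trans ?_
  · filter_upwards [hS] with ω hω
    rw [E.gain_toPolicy]
    rw [sub_le_iff_le_add]
    refine E.best_le ω fun a => ?_
    obtain ⟨c, hcov⟩ := exists_gridCode_covers hSK hT0 a
    set g := E.expertRewards (sparseBid T K q) ω
    have h1 : ∑ t, reward (a.1 (E.v t)) (E.v t) (ω t).1 ≤
        ∑ t ∈ Finset.range T, g t (some c) + 2 := by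
      rw [E.sum_expertRewards]
      calc _ ≤ ∑ t, (reward (sparseBid T K q (some c) (E.v t, (ω t).2, E.acc t)) (E.v t) (ω t).1
            + 2 / T) := Finset.sum_le_sum fun t _ =>
              reward_le_of_covers (by positivity) hcov (by exact_mod_cast hω t) _
        _ = _ := by rw [Finset.sum_add_distrib]; simp; field_simp
    -- The envelope is the reward of a bidder who knows `m`; against it the hint expert loses at
    -- most `hintLoss`.
    let u : ℕ → ℝ := fun s => if h : s < T then max ((E.v ⟨s, h⟩ : ℝ) - (ω ⟨s, h⟩).1) 0 else 0
    have hgu : ∀ t i, g t i ≤ u t := by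
      intro t i
      simp only [g, u, Environment.expertRewards]
      split_ifs
      · exact reward_le_max _ _ _
      · exact le_rfl
    have hu : ∀ t, u t ≤ 1 := by
      intro t
      simp only [u]
      split_ifs with h
      · exact max_le (by linarith [(E.v ⟨t, h⟩).2.2, (ω ⟨t, h⟩).1.2.1]) zero_le_one
      · exact zero_le_one
    have h2 := Strategy.hedge_regret_le hη0 hη3 (fun i => Strategy.const i) g u T
      (fun t _ i => by simpa using hgu t i)
      (fun t _ i => by
        have := E.expertRewards_nonneg hle ω t i
        simp only [Strategy.gain_const]
        linarith [hu t]) (some c) none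
    simp only [Strategy.gain_const] at h2
    have h3 : ∑ t ∈ Finset.range T, (u t - g t none) ≤ E.hintLoss ω := by
      refine le_trans (le_of_eq ?_) (E.sum_loss_le_hintLoss hT0 hq ω)
      rw [Finset.sum_range]
      exact Finset.sum_congr rfl fun t _ => by
        simp [u, g, Environment.expertRewards, sparseBid]
    have h4 : 2 * Real.log (Fintype.card (Option (Fin K → Fin (T + 1) × Fin (T + 1)))) / η ≤
        2 * R / η := by
      have := log_card_sparse_le (T := T) (K := K) hT hK
      gcongr
    have h5 := mul_le_mul_of_nonneg_left h3 (by positivity : 0 ≤ 3 * η)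
    linarith
  · rw [integral_add ((E.integrable_hintLoss hq).const_mul _) (integrable_const _),
      integral_const_mul]
    simp only [integral_const, probReal_univ, one_smul]
    have h1 := mul_le_mul_of_nonneg_left (E.integral_hintLoss_le hT0 hq hL)
      (by positivity : 0 ≤ 3 * η)
    have hRp : 0 < R := by linarith
    have hHp : 0 < H := by linarith
    have h2 : 3 * η * (6 * H) = 6 * √(R * H) := by
      rw [hη, Real.sqrt_div hRp.le, Real.sqrt_mul hRp.le]
      have := Real.mul_self_sqrt hHp.le
      have : 0 < √H := Real.sqrt_pos.2 hHp
      field_simp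
      nlinarith
    have h3 : 2 * R / η = 6 * √(R * H) := by
      rw [hη, Real.sqrt_div hRp.le, Real.sqrt_mul hRp.le]
      have := Real.mul_self_sqrt hRp.le
      have : 0 < √H := Real.sqrt_pos.2 hHp
      have : 0 < √R := Real.sqrt_pos.2 hRp
      field_simp
      nlinarith
    -- Hedging costs `12 √(RH)`, and the discretization cost `2` is at most `(4/3) √(RH)`; together
    -- with `√(RH) ≤ 3 √(log T · H · K)` this gives `40`.
    have h4 : 3 / 2 ≤ √(R * H) := Real.le_sqrt_of_sq_le (by nlinarith)
    rw [h3]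
    change 3 * η * _ ≤ 3 * η * (6 * H) at h1
    rw [h2] at h1
    linarith

end sparse

/-! ### The bound of order `√T (1 + log min(K, T))`. -/

section chaining

/-- Extend a finite path of labels by zeros. -/
def extendPath {J : ℕ} {F : ℕ → Finset ((ℕ → ℕ) × (ℕ → ℕ))} (x : ∀ j : Fin J, F j) (i : ℕ) :
    (ℕ → ℕ) × (ℕ → ℕ) :=
  if h : i < J then (x ⟨i, h⟩).1 else 0

lemma sum_half_pow_le (j J : ℕ) : ∑ i ∈ Finset.Ico j J, ((1 : ℝ) / 2) ^ i ≤ 2 * (1 / 2) ^ j := by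
  rcases le_total j J with h | h
  · rw [geom_sum_Ico (by norm_num) h, div_le_iff_of_neg (by norm_num)]
    have : (0 : ℝ) ≤ (1 / 2) ^ J := by positivity
    linarith
  · simp [Finset.Ico_eq_empty_of_le h]

lemma sum_three_quarters_pow_le (j₀ J : ℕ) :
    ∑ j ∈ Finset.range J, ((3 : ℝ) / 4) ^ (j - j₀) ≤ j₀ + 4 := by
  have h1 : ∀ n, ∑ j ∈ Finset.range n, ((3 : ℝ) / 4) ^ j ≤ 4 := by
    intro n
    rw [geom_sum_eq (by norm_num), div_le_iff_of_neg (by norm_num)]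
    have : (0 : ℝ) ≤ (3 / 4) ^ n := by positivity
    linarith
  calc _ ≤ ∑ j ∈ Finset.range (j₀ + J), ((3 : ℝ) / 4) ^ (j - j₀) :=
        Finset.sum_le_sum_of_subset_of_nonneg (Finset.range_mono (by omega))
          fun _ _ _ => by positivity
    _ = ∑ j ∈ Finset.range j₀, ((3 : ℝ) / 4) ^ (j - j₀) + ∑ j ∈ Finset.range J, (3 / 4) ^ j := by
        rw [Finset.sum_range_add]; simp
    _ ≤ j₀ + 4 := by
        refine add_le_add ?_ (h1 J)
        calc _ ≤ ∑ _j ∈ Finset.range j₀, (1 : ℝ) := Finset.sum_le_sum fun j hj => by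
              rw [Nat.sub_eq_zero_of_le (Finset.mem_range.1 hj).le, pow_zero]
          _ = j₀ := by simp

lemma log_card_add_one_le {n E : ℕ} (h : n ≤ 2 ^ E) : Real.log (n + 1) ≤ E + 1 := by
  have h1 : (n : ℝ) + 1 ≤ 2 ^ (E + 1) := by
    have : n + 1 ≤ 2 ^ (E + 1) := by
      have := Nat.one_le_two_pow (n := E)
      rw [pow_succ]; omega
    exact_mod_cast this
  calc Real.log (n + 1) ≤ Real.log (2 ^ (E + 1)) := Real.log_le_log (by positivity) h1
    _ = (E + 1) * Real.log 2 := by rw [Real.log_pow]; push_cast; ring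
    _ ≤ (E + 1) * 1 := by
        refine mul_le_mul_of_nonneg_left ?_ (by positivity)
        linarith [Real.log_two_lt_d9]
    _ = E + 1 := mul_one _

/-- Entropy of the label sets against the resolution of their level. -/
lemma half_pow_mul_log_card_le {j₀ k : ℕ} (hk : 1 ≤ k) (hk1 : k ≤ 2 ^ (j₀ + 1))
    {F : ℕ → Finset ((ℕ → ℕ) × (ℕ → ℕ))}
    (h1 : ∀ j < j₀, (F j).card ≤ 2 ^ (2 ^ (j + 1) + (2 ^ (j + 1) + 2)))
    (h2 : (F j₀).card ≤ 2 ^ (2 * (k + (2 ^ (j₀ + 1) + 1))))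
    (h3 : ∀ j > j₀, (F j).card ≤ 2 ^ (2 * k)) (j : ℕ) :
    2 * (1 / 2 : ℝ) ^ j * Real.log ((F j).card + 1) ≤ (5 * (3 / 4) ^ (j - j₀)) ^ 2 := by
  have hk' : (k : ℝ) ≤ 2 ^ (j₀ + 1) := by exact_mod_cast hk1
  have hk0 : (1 : ℝ) ≤ k := by exact_mod_cast hk
  have hinv : ∀ i : ℕ, (1 / 2 : ℝ) ^ i * 2 ^ i = 1 := fun i => by
    rw [← mul_pow]; norm_num
  have hle : ∀ i : ℕ, (1 / 2 : ℝ) ^ i ≤ 1 := fun i => pow_le_one₀ (by norm_num) (by norm_num)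
  have hpos : ∀ i : ℕ, (0 : ℝ) ≤ 2 * (1 / 2 : ℝ) ^ i := fun i => by positivity
  rcases lt_trichotomy j j₀ with h | rfl | h
  · rw [Nat.sub_eq_zero_of_le h.le]
    refine (mul_le_mul_of_nonneg_left (log_card_add_one_le (h1 j h)) (hpos j)).trans ?_
    have := hinv j
    have := hle j
    push_cast
    rw [pow_succ]
    nlinarith
  · rw [Nat.sub_self]
    refine (mul_le_mul_of_nonneg_left (log_card_add_one_le h2) (hpos j)).trans ?_
    have e1 := hinv j
    have e2 := hle j
    have e3 := mul_le_mul_of_nonneg_left hk' (hpos j)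
    push_cast
    rw [pow_succ] at e3 ⊢
    nlinarith
  · refine (mul_le_mul_of_nonneg_left (log_card_add_one_le (h3 j h)) (hpos j)).trans ?_
    obtain ⟨i, rfl⟩ : ∃ i, j = j₀ + i := ⟨j - j₀, by omega⟩
    rw [Nat.add_sub_cancel_left]
    have e1 := hinv j₀
    -- The entropy term decays like `2 ^ (-i)`; its square root is rounded up to the rational ratio
    -- `3/4`.
    have e4 : (1 / 2 : ℝ) ^ i ≤ ((3 / 4) ^ i) ^ 2 := by
      rw [← pow_mul, mul_comm i 2, pow_mul]
      exact pow_le_pow_left₀ (by norm_num) (by norm_num) i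
    have e5 : (((2 * k : ℕ) : ℝ) + 1) ≤ 6 * 2 ^ j₀ := by
      push_cast; rw [pow_succ] at hk'; linarith
    refine (mul_le_mul_of_nonneg_left e5 (hpos _)).trans ?_
    rw [pow_add, mul_pow]
    have e6 : (0 : ℝ) ≤ (1 / 2) ^ i := by positivity
    calc 2 * ((1 / 2 : ℝ) ^ j₀ * (1 / 2) ^ i) * (6 * 2 ^ j₀)
        = 12 * ((1 / 2 : ℝ) ^ j₀ * 2 ^ j₀) * (1 / 2) ^ i := by ring
      _ = 12 * (1 / 2) ^ i := by rw [e1, mul_one]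
      _ ≤ 5 ^ 2 * ((3 / 4) ^ i) ^ 2 := by linarith

theorem minimaxRegret_le_sqrt (hT : 1 ≤ T) (hK : 1 ≤ K) :
    minimaxRegret T K q L ≤
      ((142 * (√(T : ℝ) * (1 + Real.log (min (K : ℝ) (T : ℝ)))) : ℝ) : EReal) := by
  classical
  set k := min K T with hk
  have hk1 : 1 ≤ k := le_min hK hT
  have hkr : min (K : ℝ) (T : ℝ) = (k : ℝ) := by rw [hk, Nat.cast_min]
  set j₀ := Nat.log 2 k
  have hj1 : 2 ^ j₀ ≤ k := Nat.pow_log_le_self 2 (by omega)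
  have hj2 : k ≤ 2 ^ (j₀ + 1) := (Nat.lt_pow_succ_log_self (by norm_num) k).le
  have hj3 : (j₀ : ℝ) ≤ 2 * Real.log k := by
    have h1 : Real.log ((2 : ℝ) ^ j₀) ≤ Real.log k :=
      Real.log_le_log (by positivity) (by exact_mod_cast hj1)
    rw [Real.log_pow] at h1
    have := Real.log_two_gt_d9
    nlinarith [(Nat.cast_nonneg j₀ : (0 : ℝ) ≤ j₀)]
  obtain ⟨F, hF0, hF1, hF2, hF3, hF⟩ := exists_labels j₀ k
  have : ∀ j : Fin T, Nonempty (F j) := fun j => (hF0 j).to_subtype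
  -- With `T` levels the final error is `2 / 2 ^ T` per round, at most `2` in total.
  obtain ⟨B, hB⟩ := Strategy.exists_chaining (J := T) (X := fun j => F j) T
    (fun j => (1 / 2 : ℝ) ^ j) (fun j => by positivity)
    (fun j _ => (sum_half_pow_le j T).trans (by
      have : (1 / 2 : ℝ) ^ j ≤ 1 := pow_le_one₀ (by norm_num) (by norm_num)
      linarith)) (fun j => Classical.arbitrary _)
  let f : Fin (T + 1) × (∀ j : Fin T, F j) → ℝ → ℝ := fun i => track j₀ k (extendPath i.2) i.1
  let b : Fin (T + 1) × (∀ j : Fin T, F j) → I × I × ℝ≥0 → I := fun i c => bidOf (f i) c.1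
  have hle : ∀ i c, b i c ≤ c.1 := fun i c => bidOf_le _ _
  refine minimaxRegret_le (B.toPolicy T b (fun i =>
    (measurable_bidOf (measurable_track _)).comp measurable_fst) hle) fun E => ?_
  have hcost : ∑ j : Fin T, 7 * √((∑ i ∈ Finset.Ico (j : ℕ) T, (1 / 2 : ℝ) ^ i) * T *
      Real.log (Fintype.card (F j) + 1)) ≤ 35 * √T * (j₀ + 4) := by
    have h1 : ∀ j : ℕ, 7 * √((∑ i ∈ Finset.Ico j T, (1 / 2 : ℝ) ^ i) * T *
        Real.log (Fintype.card (F j) + 1)) ≤ 35 * √T * (3 / 4) ^ (j - j₀) := by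
      intro j
      have h2 := half_pow_mul_log_card_le hk1 hj2 hF1 hF2 hF3 j
      have h3 : 0 ≤ Real.log ((F j).card + 1) :=
        Real.log_nonneg (by linarith [(Nat.cast_nonneg (F j).card : (0 : ℝ) ≤ (F j).card)])
      have h4 : (∑ i ∈ Finset.Ico j T, (1 / 2 : ℝ) ^ i) * T * Real.log (Fintype.card (F j) + 1) ≤
          T * (5 * (3 / 4) ^ (j - j₀)) ^ 2 := by
        rw [Fintype.card_coe]
        calc _ = T * ((∑ i ∈ Finset.Ico j T, (1 / 2 : ℝ) ^ i) * Real.log ((F j).card + 1)) := by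
              ring
          _ ≤ _ := mul_le_mul_of_nonneg_left ((mul_le_mul_of_nonneg_right
              (sum_half_pow_le j T) h3).trans h2) (Nat.cast_nonneg T)
      have h5 := Real.sqrt_le_sqrt h4
      rw [Real.sqrt_mul (Nat.cast_nonneg T), Real.sqrt_sq (by positivity)] at h5
      linarith
    calc _ ≤ ∑ j : Fin T, 35 * √T * (3 / 4 : ℝ) ^ ((j : ℕ) - j₀) :=
          Finset.sum_le_sum fun j _ => h1 j
      _ = 35 * √T * ∑ j ∈ Finset.range T, (3 / 4 : ℝ) ^ (j - j₀) := by
          rw [Finset.mul_sum, Finset.sum_range]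
      _ ≤ _ := mul_le_mul_of_nonneg_left (sum_three_quarters_pow_le j₀ T) (by positivity)
  -- `j₀ ≤ 2 log k` gives `35 √T (2 log k + 4) + 2`, and `140 + 2 = 142`.
  have hbound : 35 * √(T : ℝ) * (j₀ + 4) + 2 ≤
      142 * (√(T : ℝ) * (1 + Real.log (min (K : ℝ) (T : ℝ)))) := by
    rw [hkr]
    have h1 : 1 ≤ √(T : ℝ) := Real.one_le_sqrt.2 (by exact_mod_cast hT)
    have h2 := mul_le_mul_of_nonneg_left hj3 (by linarith : 0 ≤ √(T : ℝ))
    have h3 : 0 ≤ Real.log k := Real.log_nonneg (by exact_mod_cast hk1)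
    nlinarith
  obtain ⟨S, hSK, hS⟩ := E.sparse
  refine le_trans (le_trans (regret_le_integral _ E
    (integrable_const (35 * √(T : ℝ) * (j₀ + 4) + 2)) ?_) (le_of_eq ?_)) hbound
  · filter_upwards [hS] with ω hω
    rw [E.gain_toPolicy, sub_le_iff_le_add]
    refine E.best_le ω fun a => ?_
    set g := E.expertRewards b ω
    -- Only the bids that occur matter, and there are at most `min K T` of them. Their enumeration
    -- may depend on `ω` because the label sets do not.
    have hR : (Finset.univ.image fun t => (ω t).1).card ≤ k := by
      refine le_min ((Finset.card_le_card ?_).trans hSK) (Finset.card_image_le.trans (by simp))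
      intro m hm
      obtain ⟨t, -, rfl⟩ := Finset.mem_image.1 hm
      exact hω t
    obtain ⟨s, hs, hsR⟩ := exists_monotone_enumeration _ hR
    obtain ⟨x, hx, hcov⟩ := hF a.1 s a.2.1 a.2.2 hs
    have hext : ∀ i < T, extendPath (fun j : Fin T => (⟨x j, hx j⟩ : F j)) i = x i := fun i hi => by
      simp [extendPath, hi]
    have h1 : ∑ t, reward (a.1 (E.v t)) (E.v t) (ω t).1 ≤
        ∑ t ∈ Finset.range T, g t (Fin.last T, fun j => ⟨x j, hx j⟩) + 2 := by
      rw [E.sum_expertRewards]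
      have hT2 : (T : ℝ) * (2 / 2 ^ T) ≤ 2 := by
        have : (T : ℝ) ≤ 2 ^ T := by exact_mod_cast (Nat.lt_two_pow_self (n := T)).le
        rw [mul_div_assoc', div_le_iff₀ (by positivity)]
        linarith
      calc _ ≤ ∑ t, (reward (b (Fin.last T, fun j => ⟨x j, hx j⟩)
              (E.v t, (ω t).2, E.acc t)) (E.v t) (ω t).1 + 2 / 2 ^ T) :=
            Finset.sum_le_sum fun t _ => by
              refine reward_le_of_covers (S := s '' Set.Iio k) (by positivity) ?_ ?_ _
              · simp only [f, Fin.val_last]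
                rw [track_congr hext]
                exact hcov T
              · exact hsR (by simp)
        _ ≤ _ := by
            rw [Finset.sum_add_distrib]
            simp only [Finset.sum_const, Finset.card_univ, Fintype.card_fin, nsmul_eq_mul]
            linarith
    have h2 := hB g (fun t i => E.expertRewards_nonneg hle ω t i)
      (fun t i => E.expertRewards_le_one b ω t i) (fun t j y z hyz => ?_) (fun t j y => ?_)
      (fun j => ⟨x j, hx j⟩)
    · linarith
    · have he : f (j, y) = f (j, z) := track_congr fun i hi => by
        by_cases hiJ : i < T
        · simp only [extendPath, hiJ, dif_pos, hyz ⟨i, hiJ⟩ hi]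
        · simp only [extendPath, hiJ, dif_neg, not_false_eq_true]
      simp only [g, Environment.expertRewards, b, he]
    · simp only [g, Environment.expertRewards]
      split_ifs with h
      · refine reward_le_reward_add _ (bidOf_mono ?_) (bidOf_le_add (by positivity) ?_)
          (bidOf_le _ _)
        · exact track_succ_le _ _
        · exact track_le_succ _ _
      · positivity
  · simp

end chaining

theorem minimaxRegret_upper_bound (hT : 2 ≤ T) (hK : 1 ≤ K) (hq : 1 ≤ q) (hL : 1 ≤ L) :
    minimaxRegret T K q L ≤
      ((142 * min (√(Real.log (T : ℝ) * hintRate T q L * (K : ℝ)))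
        (min (hintRate T q L) (√(T : ℝ) * (1 + Real.log (min (K : ℝ) (T : ℝ))))) : ℝ) :
          EReal) := by
  rcases min_choice (√(Real.log (T : ℝ) * hintRate T q L * (K : ℝ)))
    (min (hintRate T q L) (√(T : ℝ) * (1 + Real.log (min (K : ℝ) (T : ℝ))))) with h | h
  · rw [h]
    refine (minimaxRegret_le_sparse hT hK hq hL).trans (EReal.coe_le_coe_iff.2 ?_)
    have := Real.sqrt_nonneg (Real.log (T : ℝ) * hintRate T q L * (K : ℝ))
    linarith
  · rw [h]
    rcases min_choice (hintRate T q L)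
      (√(T : ℝ) * (1 + Real.log (min (K : ℝ) (T : ℝ)))) with h' | h'
    · rw [h']
      refine (minimaxRegret_le_hintRate (by omega) hq hL).trans (EReal.coe_le_coe_iff.2 ?_)
      have := hintRate_pos (T := T) (q := q) (by omega) hL
      linarith
    · rw [h']
      exact minimaxRegret_le_sqrt (by omega) hK

/-! ### Lower bound on the mean positive part of an independent sum. -/

section moments

variable {Ω : Type*} [MeasurableSpace Ω] {μ : Measure Ω} [IsProbabilityMeasure μ]

lemma integrable_of_abs_le {f : Ω → ℝ} (hf : Measurable f) {C : ℝ} (h : ∀ ω, |f ω| ≤ C) :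
    Integrable f μ :=
  Integrable.of_bound hf.aestronglyMeasurable C (ae_of_all _ h)

/-- First, second and fourth moments of a sum of independent centred variables bounded by `1`. -/
lemma moments_sum_of_iIndepFun {ι : Type*} {X : ι → Ω → ℝ} (hind : iIndepFun X μ)
    (hm : ∀ i, Measurable (X i)) (hb : ∀ i ω, |X i ω| ≤ 1) (h0 : ∀ i, ∫ ω, X i ω ∂μ = 0)
    (s : Finset ι) :
    ∫ ω, (∑ i ∈ s, X i ω) ∂μ = 0 ∧
    ∫ ω, (∑ i ∈ s, X i ω) ^ 2 ∂μ = ∑ i ∈ s, ∫ ω, X i ω ^ 2 ∂μ ∧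
    ∫ ω, (∑ i ∈ s, X i ω) ^ 4 ∂μ ≤
      3 * (∑ i ∈ s, ∫ ω, X i ω ^ 2 ∂μ) ^ 2 + ∑ i ∈ s, ∫ ω, X i ω ^ 2 ∂μ := by
  classical
  induction s using Finset.induction_on with
  | empty => simp
  | insert a s ha ih =>
    obtain ⟨ih1, ih2, ih4⟩ := ih
    set W : Ω → ℝ := fun ω => ∑ i ∈ s, X i ω with hW
    set Y : Ω → ℝ := X a with hY
    have hWm : Measurable W := Finset.measurable_sum _ fun i _ => hm i
    have hWb : ∀ ω, |W ω| ≤ s.card := fun ω => by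
      refine (Finset.abs_sum_le_sum_abs _ _).trans ((Finset.sum_le_sum fun i _ => hb i ω).trans ?_)
      simp
    have hindWY : IndepFun W Y μ := by
      have := hind.indepFun_finsetSum_of_notMem hm ha
      convert this using 1
      funext ω; simp [hW]
    have hint : ∀ k l : ℕ, Integrable (fun ω => W ω ^ k * Y ω ^ l) μ := by
      intro k l
      refine integrable_of_abs_le (C := (s.card : ℝ) ^ k) (by fun_prop) fun ω => ?_
      rw [abs_mul, abs_pow, abs_pow]
      calc _ ≤ (s.card : ℝ) ^ k * 1 := mul_le_mul (pow_le_pow_left₀ (abs_nonneg _) (hWb ω) k)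
            (pow_le_one₀ (abs_nonneg _) (hb a ω)) (by positivity) (by positivity)
        _ = _ := mul_one _
    have hmul : ∀ k l : ℕ, ∫ ω, W ω ^ k * Y ω ^ l ∂μ = (∫ ω, W ω ^ k ∂μ) * ∫ ω, Y ω ^ l ∂μ := by
      intro k l
      have h1 : IndepFun (fun ω => W ω ^ k) (fun ω => Y ω ^ l) μ :=
        hindWY.comp (φ := fun x => x ^ k) (ψ := fun x => x ^ l) (by fun_prop) (by fun_prop)
      exact h1.integral_fun_mul_eq_mul_integral (by fun_prop) (by fun_prop)
    have hWY : ∀ ω, ∑ i ∈ insert a s, X i ω = W ω + Y ω := fun ω => by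
      rw [Finset.sum_insert ha, add_comm]
    have hY0 : ∫ ω, Y ω ^ 1 ∂μ = 0 := by simpa using h0 a
    have hW0 : ∫ ω, W ω ^ 1 ∂μ = 0 := by simpa using ih1
    have hY4 : ∫ ω, Y ω ^ 4 ∂μ ≤ ∫ ω, Y ω ^ 2 ∂μ := by
      refine integral_mono (by simpa using hint 0 4) (by simpa using hint 0 2) fun ω => ?_
      have : Y ω ^ 2 ≤ 1 := by rw [← sq_abs]; exact pow_le_one₀ (abs_nonneg _) (hb a ω)
      show Y ω ^ 4 ≤ Y ω ^ 2
      nlinarith [sq_nonneg (Y ω)]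
    have hy0 : 0 ≤ ∫ ω, Y ω ^ 2 ∂μ := integral_nonneg fun ω => sq_nonneg _
    have hV0 : 0 ≤ ∑ i ∈ s, ∫ ω, X i ω ^ 2 ∂μ :=
      Finset.sum_nonneg fun i _ => integral_nonneg fun ω => sq_nonneg _
    simp only [hWY, Finset.sum_insert ha]
    refine ⟨?_, ?_, ?_⟩
    · have e : ∀ ω, W ω + Y ω = W ω ^ 1 * Y ω ^ 0 + W ω ^ 0 * Y ω ^ 1 := fun ω => by ring
      simp only [e]
      rw [integral_add (hint 1 0) (hint 0 1), hmul, hmul, hW0, hY0]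
      ring
    · have e : ∀ ω, (W ω + Y ω) ^ 2 =
          W ω ^ 2 * Y ω ^ 0 + (2 * (W ω ^ 1 * Y ω ^ 1) + W ω ^ 0 * Y ω ^ 2) := fun ω => by ring
      simp only [e]
      rw [integral_add (hint 2 0) (((hint 1 1).const_mul 2).fun_add (hint 0 2)),
        integral_add ((hint 1 1).const_mul 2) (hint 0 2), integral_const_mul, hmul, hmul, hmul,
        hY0, ih2]
      simp only [pow_zero, integral_const, probReal_univ, smul_eq_mul]
      ring
    -- Cross terms with a first power vanish. What remains is `E W⁴ + 6 E W² E Y² + E Y⁴`, and `E Y⁴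
    -- ≤ E Y²` because `|Y| ≤ 1`.
    · have e : ∀ ω, (W ω + Y ω) ^ 4 =
          W ω ^ 4 * Y ω ^ 0 + (4 * (W ω ^ 3 * Y ω ^ 1) + (6 * (W ω ^ 2 * Y ω ^ 2) +
            (4 * (W ω ^ 1 * Y ω ^ 3) + W ω ^ 0 * Y ω ^ 4))) := fun ω => by ring
      simp only [e]
      have i1 := ((hint 1 3).const_mul 4).fun_add (hint 0 4)
      have i2 := ((hint 2 2).const_mul 6).fun_add i1
      have i3 := ((hint 3 1).const_mul 4).fun_add i2
      rw [integral_add (hint 4 0) i3, integral_add ((hint 3 1).const_mul 4) i2,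
        integral_add ((hint 2 2).const_mul 6) i1,
        integral_add ((hint 1 3).const_mul 4) (hint 0 4),
        integral_const_mul, integral_const_mul, integral_const_mul,
        hmul, hmul, hmul, hmul, hmul, hY0, hW0, ih2]
      simp only [pow_zero, integral_const, probReal_univ, smul_eq_mul, one_mul, mul_one]
      nlinarith

/-- A centred variable with `E W ^ 2 = V` and `E W ^ 4 ≤ 46 V ^ 2` has `E W⁺ ≥ √V / 20`. -/
lemma integral_max_zero_ge {W : Ω → ℝ} (hWm : Measurable W) {C : ℝ} (hWb : ∀ ω, |W ω| ≤ C)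
    (h0 : ∫ ω, W ω ∂μ = 0) {V : ℝ} (hV : 0 < V) (h2 : ∫ ω, W ω ^ 2 ∂μ = V)
    (h4 : ∫ ω, W ω ^ 4 ∂μ ≤ 46 * V ^ 2) :
    √V / 20 ≤ ∫ ω, max (W ω) 0 ∂μ := by
  set r := √V with hr
  have hr0 : 0 < r := Real.sqrt_pos.2 hV
  have hrV : r ^ 2 = V := Real.sq_sqrt hV.le
  have hi1 : Integrable W μ := integrable_of_abs_le hWm hWb
  have hi : ∀ k : ℕ, Integrable (fun ω => W ω ^ k) μ := fun k =>
    integrable_of_abs_le (C := C ^ k) (by fun_prop) fun ω => by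
      rw [abs_pow]; exact pow_le_pow_left₀ (abs_nonneg _) (hWb ω) k
  have him : Integrable (fun ω => max (W ω) 0) μ := integrable_of_abs_le (C := C) (by fun_prop)
    fun ω => by
      refine le_trans ?_ (hWb ω)
      rw [abs_of_nonneg (le_max_right _ _)]
      exact max_le (le_abs_self _) (abs_nonneg _)
  -- `max W 0 = (W + |W|)/2`, and `|W|` is minorized by an even quartic through `y² - y⁴/4 ≤ y` at
  -- `y = |W|/(5r)`. In expectation this yields `r/10 - 46r/1000 ≥ r/20`.
  have key : ∀ ω, (1 / 2) * W ω + ((1 / (10 * r)) * W ω ^ 2 + -(1 / (1000 * r ^ 3)) * W ω ^ 4) ≤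
      max (W ω) 0 := by
    intro ω
    have h5 : ∀ y : ℝ, 0 ≤ y → y ^ 2 - y ^ 4 / 4 ≤ y := by
      intro y hy
      nlinarith [mul_nonneg hy (mul_nonneg (by linarith : 0 ≤ y + 2) (sq_nonneg (y - 1))),
        mul_nonneg hy (sq_nonneg (y - 1)), mul_nonneg hy hy,
        mul_nonneg hy (mul_nonneg (by linarith : 0 ≤ y + 2.4) (sq_nonneg (y - 1.2)))]
    have h6 := h5 (|W ω| / (5 * r)) (by positivity)
    rw [div_pow, div_pow, sq_abs, (by decide : Even 4).pow_abs] at h6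
    have h7 : max (W ω) 0 = (1 / 2) * W ω + (5 * r / 2) * (|W ω| / (5 * r)) := by
      rcases le_total 0 (W ω) with h | h
      · rw [max_eq_left h, abs_of_nonneg h]; field_simp; ring
      · rw [max_eq_right h, abs_of_nonpos h]; field_simp; ring
    rw [h7]
    have h8 := mul_le_mul_of_nonneg_left h6 (by positivity : 0 ≤ 5 * r / 2)
    have h9 : 5 * r / 2 * (W ω ^ 2 / (5 * r) ^ 2 - W ω ^ 4 / (5 * r) ^ 4 / 4) =
        (1 / (10 * r)) * W ω ^ 2 + -(1 / (1000 * r ^ 3)) * W ω ^ 4 := by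
      field_simp; ring
    linarith
  have h10 := integral_mono ((hi1.const_mul (1 / 2)).fun_add (((hi 2).const_mul (1 / (10 * r))).fun_add
    ((hi 4).const_mul (-(1 / (1000 * r ^ 3)))))) him key
  rw [integral_add (hi1.const_mul (1 / 2)) (((hi 2).const_mul (1 / (10 * r))).fun_add
    ((hi 4).const_mul (-(1 / (1000 * r ^ 3))))), integral_add ((hi 2).const_mul (1 / (10 * r)))
    ((hi 4).const_mul (-(1 / (1000 * r ^ 3)))), integral_const_mul, integral_const_mul,
    integral_const_mul, h0, h2] at h10
  refine le_trans ?_ h10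
  have h11 := mul_le_mul_of_nonneg_left h4 (by positivity : 0 ≤ 1 / (1000 * r ^ 3))
  have h12 : 1 / (1000 * r ^ 3) * (46 * V ^ 2) = 46 / 1000 * r := by
    rw [← hrV]; field_simp
  have h13 : 1 / (10 * r) * V = r / 10 := by rw [← hrV]; field_simp
  rw [h12] at h11
  rw [h13]
  linarith

end moments

/-! ### Resampling one round of a product law. -/

section resample

variable {ι : Type*} [Fintype ι] [DecidableEq ι] {α : ι → Type*} [∀ i, MeasurableSpace (α i)]

/-- Resampling one coordinate of a product measure preserves it. -/
lemma measurePreserving_update (μ : ∀ i, Measure (α i)) [∀ i, IsProbabilityMeasure (μ i)] (t : ι) :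
    MeasurePreserving (fun p : (∀ i, α i) × α t => Function.update p.1 t p.2)
      ((Measure.pi μ).prod (μ t)) (Measure.pi μ) := by
  have hm : Measurable fun p : (∀ i, α i) × α t => Function.update p.1 t p.2 := by
    refine measurable_pi_lambda _ fun i => ?_
    by_cases h : i = t
    · subst h; simpa using measurable_snd
    · simp only [Function.update_of_ne h]
      exact (measurable_pi_apply i).comp measurable_fst
  refine ⟨hm, (Measure.pi_eq fun s hs => ?_).symm⟩
  rw [Measure.map_apply hm (MeasurableSet.univ_pi hs)]
  have hpre : (fun p : (∀ i, α i) × α t => Function.update p.1 t p.2) ⁻¹' Set.univ.pi s =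
      (Set.univ.pi (Function.update s t Set.univ)) ×ˢ s t := by
    ext ⟨ω, y⟩
    simp only [Set.mem_preimage, Set.mem_pi, Set.mem_univ, true_implies, Set.mem_prod]
    constructor
    · refine fun h => ⟨fun i => ?_, by simpa using h t⟩
      by_cases hi : i = t
      · subst hi; simp
      · simpa [hi] using h i
    · rintro ⟨h1, h2⟩ i
      by_cases hi : i = t
      · subst hi; simpa using h2
      · simpa [hi] using h1 i
  rw [hpre, Measure.prod_prod, Measure.pi_pi, ← Finset.prod_erase_mul _ _ (Finset.mem_univ t),
    ← Finset.prod_erase_mul _ (fun i => μ i (s i)) (Finset.mem_univ t)]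
  simp only [Function.update_self, measure_univ, mul_one]
  congr 1
  refine Finset.prod_congr rfl fun i hi => ?_
  rw [Function.update_of_ne (Finset.ne_of_mem_erase hi)]

/-- Integrating over round `t` with the other rounds fixed replaces conditioning on the history. -/
lemma integral_pi_eq_integral_update (μ : ∀ i, Measure (α i)) [∀ i, IsProbabilityMeasure (μ i)]
    (t : ι) {f : (∀ i, α i) → ℝ} (hf : Measurable f) {C : ℝ} (hC : ∀ ω, |f ω| ≤ C) :
    ∫ ω, f ω ∂(Measure.pi μ) = ∫ ω, ∫ y, f (Function.update ω t y) ∂(μ t) ∂(Measure.pi μ) := by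
  have hmp := measurePreserving_update μ t
  rw [← hmp.map_eq, integral_map hmp.measurable.aemeasurable hf.aestronglyMeasurable, hmp.map_eq,
    integral_prod]
  exact integrable_of_abs_le (hf.comp hmp.measurable) fun p => hC _

end resample

/-! ### The hard environment. -/

/-- The `i`-th point of the grid of step `δ`. -/
noncomputable def gridPoint (δ : ℝ) (i : ℕ) : I := Set.projIcc 0 1 zero_le_one (i * δ)

/-- The private value of the `i`-th bin. -/
noncomputable def binValue (δ : ℝ) (i : ℕ) : I := Set.projIcc 0 1 zero_le_one (1 / 2 + 2 * i * δ)

/-- Surplus in bin `i` when winning with the low bid. -/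
noncomputable def binSurplus (δ : ℝ) (i : ℕ) : ℝ := 1 / 2 + i * δ

/-- Law of (highest competing bid, hint) in bin `i`: the hint is the low grid point, and the bid is
one step higher with the probability that makes both bids equally good. -/
noncomputable def binLaw (δ : ℝ) (i : ℕ) : Measure (I × I) :=
  ENNReal.ofReal (1 - δ / binSurplus δ i) • Measure.dirac (gridPoint δ i, gridPoint δ i) +
    ENNReal.ofReal (δ / binSurplus δ i) • Measure.dirac (gridPoint δ (i + 1), gridPoint δ i)

/-- Centred reward of the low bid in bin `i`. -/
noncomputable def binExcess (δ : ℝ) (i : ℕ) (y : I × I) : ℝ :=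
  (if y.1 ≤ gridPoint δ i then binSurplus δ i else 0) - (binSurplus δ i - δ)

section bins
variable {δ : ℝ} {i n : ℕ}

lemma coe_gridPoint (hδ : 0 < δ) (hn : 4 * n * δ ≤ 1) (hi : i ≤ n) :
    (gridPoint δ i : ℝ) = i * δ := by
  have : (i : ℝ) ≤ n := by exact_mod_cast hi
  rw [gridPoint, Set.projIcc_of_mem zero_le_one ⟨by positivity, by nlinarith⟩]

lemma coe_binValue (hδ : 0 < δ) (hn : 4 * n * δ ≤ 1) (hi : i ≤ n) :
    (binValue δ i : ℝ) = 1 / 2 + 2 * i * δ := by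
  have : (i : ℝ) ≤ n := by exact_mod_cast hi
  rw [binValue, Set.projIcc_of_mem zero_le_one ⟨by positivity, by nlinarith⟩]

lemma half_le_binSurplus (hδ : 0 < δ) : 1 / 2 ≤ binSurplus δ i := by
  unfold binSurplus
  have : 0 ≤ i * δ := by positivity
  linarith

lemma binSurplus_le_one (hδ : 0 < δ) (hn : 4 * n * δ ≤ 1) (hi : i ≤ n) : binSurplus δ i ≤ 1 := by
  have : (i : ℝ) ≤ n := by exact_mod_cast hi
  unfold binSurplus
  nlinarith

lemma jumpProb_mem (hδ : 0 < δ) (hδ8 : δ ≤ 1 / 8) :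
    0 < δ / binSurplus δ i ∧ δ / binSurplus δ i ≤ 2 * δ ∧ δ / binSurplus δ i ≤ 1 := by
  have h := half_le_binSurplus (i := i) hδ
  have h1 : 0 < binSurplus δ i := by linarith
  have h2 : δ / binSurplus δ i ≤ 2 * δ := by
    rw [div_le_iff₀ h1]; nlinarith
  exact ⟨by positivity, h2, by linarith⟩

lemma isProbabilityMeasure_binLaw (hδ : 0 < δ) (hδ8 : δ ≤ 1 / 8) (i : ℕ) :
    IsProbabilityMeasure (binLaw δ i) := by
  obtain ⟨h1, -, h2⟩ := jumpProb_mem (i := i) hδ hδ8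
  constructor
  simp only [binLaw, Measure.add_apply, Measure.smul_apply, measure_univ, smul_eq_mul, mul_one]
  rw [← ENNReal.ofReal_add (by linarith) h1.le]
  simp

lemma integral_binLaw (hδ : 0 < δ) (hδ8 : δ ≤ 1 / 8) (i : ℕ) (f : I × I → ℝ) :
    ∫ y, f y ∂(binLaw δ i) = (1 - δ / binSurplus δ i) * f (gridPoint δ i, gridPoint δ i) +
      δ / binSurplus δ i * f (gridPoint δ (i + 1), gridPoint δ i) := by
  obtain ⟨h1, -, h2⟩ := jumpProb_mem (i := i) hδ hδ8
  have hint : ∀ (c : ℝ) (y : I × I), Integrable f (ENNReal.ofReal c • Measure.dirac y) := fun c y =>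
    (integrable_dirac (by simp)).smul_measure ENNReal.ofReal_ne_top
  rw [binLaw, integral_add_measure (hint _ _) (hint _ _), integral_smul_measure,
    integral_smul_measure, integral_dirac, integral_dirac, ENNReal.toReal_ofReal (by linarith),
    ENNReal.toReal_ofReal h1.le]
  simp

lemma ae_binLaw (δ : ℝ) (i : ℕ) : ∀ᵐ y ∂(binLaw δ i),
    y = (gridPoint δ i, gridPoint δ i) ∨ y = (gridPoint δ (i + 1), gridPoint δ i) := by
  have hs : MeasurableSet {y : I × I | ¬ (y = (gridPoint δ i, gridPoint δ i) ∨
      y = (gridPoint δ (i + 1), gridPoint δ i))} :=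
    ((measurableSet_singleton _).union (measurableSet_singleton _)).compl
  rw [ae_iff, binLaw]
  simp only [Measure.add_apply, Measure.smul_apply, smul_eq_mul]
  rw [Measure.dirac_apply' _ hs, Measure.dirac_apply' _ hs]
  simp

lemma measurable_binExcess (δ : ℝ) (i : ℕ) : Measurable (binExcess δ i) :=
  (Measurable.ite (measurableSet_le measurable_fst measurable_const) measurable_const
    measurable_const).sub_const _

lemma abs_binExcess_le (hδ : 0 < δ) (hδ8 : δ ≤ 1 / 8) (hn : 4 * n * δ ≤ 1) (hi : i ≤ n)
    (y : I × I) : |binExcess δ i y| ≤ 1 := by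
  have h1 := half_le_binSurplus (i := i) hδ
  have h2 := binSurplus_le_one hδ hn hi
  unfold binExcess
  rw [abs_le]
  split_ifs <;> constructor <;> linarith

lemma gridPoint_lt_succ (hδ : 0 < δ) (hn : 4 * n * δ ≤ 1) (hi : i < n) :
    gridPoint δ i < gridPoint δ (i + 1) := by
  show (gridPoint δ i : ℝ) < gridPoint δ (i + 1)
  rw [coe_gridPoint hδ hn hi.le, coe_gridPoint hδ hn hi]
  push_cast
  linarith

lemma binExcess_low (δ : ℝ) (i : ℕ) : binExcess δ i (gridPoint δ i, gridPoint δ i) = δ := by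
  simp [binExcess]

lemma binExcess_high (hδ : 0 < δ) (hn : 4 * n * δ ≤ 1) (hi : i < n) :
    binExcess δ i (gridPoint δ (i + 1), gridPoint δ i) = -(binSurplus δ i - δ) := by
  simp only [binExcess]
  rw [if_neg (gridPoint_lt_succ hδ hn hi).not_ge, zero_sub]

lemma integral_binExcess (hδ : 0 < δ) (hδ8 : δ ≤ 1 / 8) (hn : 4 * n * δ ≤ 1) (hi : i < n) :
    ∫ y, binExcess δ i y ∂(binLaw δ i) = 0 := by
  have h1 := half_le_binSurplus (i := i) hδ
  have : binSurplus δ i ≠ 0 := by linarith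
  rw [integral_binLaw hδ hδ8, binExcess_low, binExcess_high hδ hn hi]
  field_simp
  ring

lemma integral_binExcess_sq (hδ : 0 < δ) (hδ8 : δ ≤ 1 / 8) (hn : 4 * n * δ ≤ 1) (hi : i < n) :
    ∫ y, binExcess δ i y ^ 2 ∂(binLaw δ i) = δ * (binSurplus δ i - δ) := by
  have h1 := half_le_binSurplus (i := i) hδ
  have : binSurplus δ i ≠ 0 := by linarith
  rw [integral_binLaw hδ hδ8, binExcess_low, binExcess_high hδ hn hi]
  field_simp
  ring

/-- No bid earns more than `binSurplus δ i - δ` in expectation. -/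
lemma expected_reward_le (hδ : 0 < δ) (hδ8 : δ ≤ 1 / 8) (hn : 4 * n * δ ≤ 1) (hi : i < n) (b : I) :
    (1 - δ / binSurplus δ i) * reward b (binValue δ i) (gridPoint δ i) +
      δ / binSurplus δ i * reward b (binValue δ i) (gridPoint δ (i + 1)) ≤ binSurplus δ i - δ := by
  obtain ⟨p1, -, p2⟩ := jumpProb_mem (i := i) hδ hδ8
  have h1 := half_le_binSurplus (i := i) hδ
  have hlt := gridPoint_lt_succ hδ hn hi
  have e1 := coe_binValue hδ hn hi.le
  have e2 := coe_gridPoint hδ hn hi.le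
  have e3 := coe_gridPoint hδ hn (Nat.succ_le_of_lt hi)
  have hp : δ / binSurplus δ i * binSurplus δ i = δ := by
    rw [div_mul_cancel₀]; linarith
  set p := δ / binSurplus δ i
  have hS : (binValue δ i : ℝ) - gridPoint δ i = binSurplus δ i := by
    rw [e1, e2, binSurplus]; ring
  have hS' : (binValue δ i : ℝ) - gridPoint δ (i + 1) = binSurplus δ i - δ := by
    rw [e1, e3, binSurplus]; push_cast; ring
  unfold reward
  by_cases c1 : gridPoint δ (i + 1) ≤ b
  · have c1' : (gridPoint δ (i + 1) : ℝ) ≤ b := c1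
    rw [if_pos (hlt.le.trans c1), if_pos c1]
    linarith
  · by_cases c2 : gridPoint δ i ≤ b
    · have c2' : (gridPoint δ i : ℝ) ≤ b := c2
      rw [if_pos c2, if_neg c1]
      have := mul_le_mul_of_nonneg_left (by linarith : (binValue δ i : ℝ) - b ≤ binSurplus δ i)
        (by linarith : 0 ≤ 1 - p)
      linarith
    · rw [if_neg c2, if_neg c1]
      linarith

/-- Some oracle raises its bid by a prescribed part of a grid step in each bin. -/
lemma exists_oracle_of_bins (hδ : 0 < δ) (hn : 4 * n * δ ≤ 1) (hn1 : 1 ≤ n) (e : ℕ → ℝ)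
    (he0 : ∀ i, 0 ≤ e i) (he1 : ∀ i, e i ≤ 1) :
    ∃ a : Oracle, ∀ i < n, (a.1 (binValue δ i) : ℝ) = (i + e i) * δ := by
  have hne : (Finset.range n).Nonempty := Finset.nonempty_range_iff.2 (by omega)
  -- The smallest nonnegative, nondecreasing, 1-Lipschitz function reaching the prescribed bids.
  -- Values are spaced `2δ` and low bids `δ`, so consecutive prescribed bids differ by between `0`
  -- and `2δ`, and no bin constrains another.
  let g : ℕ → ℝ → ℝ := fun i x => max 0 ((i + e i) * δ - max 0 (1 / 2 + 2 * i * δ - x))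
  let f : ℝ → ℝ := fun x => (Finset.range n).sup' hne fun i => g i x
  have hgf : ∀ i < n, ∀ x, g i x ≤ f x := fun i hi x =>
    Finset.le_sup' (fun i => g i x) (Finset.mem_range.2 hi)
  have hmono : Monotone f := fun x y hxy => Finset.sup'_le _ _ fun i hi => by
    refine le_trans ?_ (hgf i (Finset.mem_range.1 hi) y)
    exact max_le_max le_rfl (sub_le_sub_left (max_le_max le_rfl (by linarith)) _)
  have hlip : ∀ x y, f x ≤ f y + |x - y| := fun x y => Finset.sup'_le _ _ fun i hi => by
    have h1 := hgf i (Finset.mem_range.1 hi) y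
    have h2 : g i x ≤ g i y + |x - y| := by
      have h3 : max 0 (1 / 2 + 2 * i * δ - y) ≤ max 0 (1 / 2 + 2 * i * δ - x) + |x - y| :=
        max_le (by positivity) (by
          linarith [le_max_right 0 (1 / 2 + 2 * i * δ - x), le_abs_self (x - y)])
      refine max_le (by positivity) ?_
      have := le_max_right 0 ((i + e i) * δ - max 0 (1 / 2 + 2 * i * δ - y))
      simp only [g]
      linarith
    linarith
  have hf0 : ∀ x, 0 ≤ f x := fun x => (le_max_left _ _).trans (hgf 0 hn1 x)
  have hf1 : ∀ x, f x ≤ 1 := fun x => Finset.sup'_le _ _ fun i hi => by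
    have h1 : (i : ℝ) + 1 ≤ n := by exact_mod_cast Finset.mem_range.1 hi
    have h2 := le_max_left 0 (1 / 2 + 2 * i * δ - x)
    have := he1 i
    refine max_le zero_le_one ?_
    nlinarith
  refine ⟨⟨fun x => ⟨f x, hf0 x, hf1 x⟩, LipschitzWith.of_dist_le_mul fun x y => ?_,
    fun x y hxy => hmono hxy⟩, fun j hj => ?_⟩
  · rw [Subtype.dist_eq, Subtype.dist_eq, Real.dist_eq, Real.dist_eq, NNReal.coe_one, one_mul,
      abs_le]
    have h1 := hlip x y
    have h2 := hlip y x
    rw [abs_sub_comm] at h2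
    constructor <;> simp only <;> linarith
  · show f (binValue δ j) = _
    rw [coe_binValue hδ hn hj.le]
    have hj0 := he0 j
    refine le_antisymm (Finset.sup'_le _ _ fun i hi => max_le (by positivity) ?_) ?_
    · have hei := he1 i
      rcases lt_trichotomy i j with h | rfl | h
      · have h1 : (i : ℝ) + 1 ≤ j := by exact_mod_cast h
        have h2 := le_max_left 0 (1 / 2 + 2 * i * δ - (1 / 2 + 2 * j * δ))
        nlinarith
      · linarith [le_max_left 0 (1 / 2 + 2 * i * δ - (1 / 2 + 2 * i * δ))]
      · have h1 : (j : ℝ) + 1 ≤ i := by exact_mod_cast h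
        have h2 := le_max_right 0 (1 / 2 + 2 * i * δ - (1 / 2 + 2 * j * δ))
        nlinarith
    · refine le_trans ?_ (hgf j hj _)
      refine le_trans (le_of_eq ?_) (le_max_right _ _)
      simp

end bins

/-- Parameters for which the bins form an environment. -/
structure HardParams (T K : ℕ) (q L : ℝ) (n : ℕ) (δ : ℝ) : Prop where
  one_le_T : 1 ≤ T
  one_le_n : 1 ≤ n
  n_lt_K : n + 1 ≤ K
  pos : 0 < δ
  le_eighth : δ ≤ 1 / 8
  n_mul_le : 4 * n * δ ≤ 1
  -- Keeps the variance collected in each bin bounded below.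
  n_le : (n : ℝ) ≤ 8 * δ * T
  one_le_q : 1 ≤ q
  nonneg : 0 ≤ L
  -- The hint errs by `δ` with probability at most `2δ`.
  hint : 2 * δ * δ ^ q ≤ (L / T) ^ q

section hard
variable {n : ℕ} {δ : ℝ}

/-- Rounds cycle through the bins; competing bids are independent. -/
noncomputable def hardLaw (T n : ℕ) (δ : ℝ) : Measure (Fin T → I × I) :=
  Measure.pi fun t : Fin T => binLaw δ (t % n)

namespace HardParams

variable (h : HardParams T K q L n δ)
include h

lemma isProb (t : Fin T) : IsProbabilityMeasure (binLaw δ (t % n)) :=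
  isProbabilityMeasure_binLaw h.pos h.le_eighth _

lemma mod_lt (t : ℕ) : t % n < n := Nat.mod_lt _ h.one_le_n

lemma integral_eval (t : Fin T) {f : I × I → ℝ} (hf : Measurable f) :
    ∫ ω, f (ω t) ∂(hardLaw T n δ) = ∫ y, f y ∂(binLaw δ (t % n)) := by
  have := h.isProb
  have hmp := measurePreserving_eval (fun t : Fin T => binLaw δ (t % n)) t
  rw [← hmp.map_eq, integral_map hmp.measurable.aemeasurable hf.aestronglyMeasurable]
  rfl

lemma ae_hardLaw : ∀ᵐ ω ∂(hardLaw T n δ), ∀ t : Fin T,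
    ω t = (gridPoint δ (t % n), gridPoint δ (t % n)) ∨
      ω t = (gridPoint δ (t % n + 1), gridPoint δ (t % n)) := by
  have := h.isProb
  rw [ae_all_iff]
  intro t
  exact (Measure.quasiMeasurePreserving_eval (fun t : Fin T => binLaw δ (t % n)) t).ae
    (ae_binLaw δ (t % n))

/-- The environment of the lower bound. -/
noncomputable def env : Environment T K q L where
  v t := binValue δ (t % n)
  acc _ := (L / T).toNNReal
  law := hardLaw T n δ
  isProb := by
    have := h.isProb
    unfold hardLaw; infer_instance
  hint t := by
    have hL : 0 ≤ L / T := div_nonneg h.nonneg (Nat.cast_nonneg T)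
    have hq : q ≠ 0 := by linarith [h.one_le_q]
    rw [h.integral_eval t (f := fun y => |(y.2 : ℝ) - (y.1 : ℝ)| ^ q) (by fun_prop),
      integral_binLaw h.pos h.le_eighth, Real.coe_toNNReal _ hL]
    have hi := h.mod_lt t
    have e : |(gridPoint δ (t % n) : ℝ) - gridPoint δ (t % n + 1)| = δ := by
      rw [coe_gridPoint h.pos h.n_mul_le hi.le, coe_gridPoint h.pos h.n_mul_le hi, abs_sub_comm]
      push_cast
      rw [show ((t % n : ℕ) + 1 : ℝ) * δ - (t % n : ℕ) * δ = δ by ring, abs_of_pos h.pos]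
    simp only [sub_self, abs_zero, Real.zero_rpow hq, mul_zero, zero_add, e]
    obtain ⟨-, p2, -⟩ := jumpProb_mem (i := t % n) h.pos h.le_eighth
    exact (mul_le_mul_of_nonneg_right p2 (Real.rpow_nonneg h.pos.le q)).trans h.hint
  total := by
    have hT : (T : ℝ) ≠ 0 := by have := h.one_le_T; positivity
    have hL : 0 ≤ L / T := div_nonneg h.nonneg (Nat.cast_nonneg T)
    simp [hL]
    field_simp
  sparse := by
    classical
    refine ⟨(Finset.range (n + 1)).image (gridPoint δ), Finset.card_image_le.trans (by
      simpa using h.n_lt_K), ?_⟩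
    filter_upwards [h.ae_hardLaw] with ω hω t
    have hi := h.mod_lt t
    rcases hω t with e | e <;> rw [e] <;> refine Finset.mem_image_of_mem _ (Finset.mem_range.2 ?_)
    · omega
    · omega

/-- Cumulative centred reward of the low bid in bin `i`. -/
noncomputable def binTotal (_h : HardParams T K q L n δ) (i : ℕ) (ω : Fin T → I × I) : ℝ :=
  ∑ t ∈ Finset.univ.filter (fun t : Fin T => (t : ℕ) % n = i), binExcess δ (t % n) (ω t)

lemma measurable_binTotal (i : ℕ) : Measurable (h.binTotal i) :=
  Finset.measurable_sum _ fun t _ => (measurable_binExcess _ _).comp (measurable_pi_apply t)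

lemma abs_binTotal_le (i : ℕ) (ω : Fin T → I × I) : |h.binTotal i ω| ≤ T := by
  refine (Finset.abs_sum_le_sum_abs _ _).trans ((Finset.sum_le_sum (g := fun _ => (1 : ℝ))
    fun (t : Fin T) _ => abs_binExcess_le h.pos h.le_eighth h.n_mul_le (h.mod_lt t).le _).trans ?_)
  simp only [Finset.sum_const, nsmul_eq_mul, mul_one]
  exact_mod_cast (Finset.card_filter_le _ _).trans (by simp)

/-- The oracle bids low in the bins whose centred total is nonnegative and high in the others; the
high bid always earns exactly `binSurplus - δ`. -/
lemma best_ge : ∀ᵐ ω ∂(hardLaw T n δ),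
    ∑ t : Fin T, (binSurplus δ (t % n) - δ) + ∑ i ∈ Finset.range n, max (h.binTotal i ω) 0 ≤
      h.env.best ω := by
  classical
  filter_upwards [h.ae_hardLaw] with ω hω
  obtain ⟨a, ha⟩ := exists_oracle_of_bins h.pos h.n_mul_le h.one_le_n
    (fun i => if 0 ≤ h.binTotal i ω then 0 else 1) (fun i => by positivity)
    (fun i => by split_ifs <;> norm_num)
  refine le_trans (le_of_eq ?_) (h.env.le_best ω a)
  have h1 : ∀ t : Fin T, reward (a.1 (h.env.v t)) (h.env.v t) (ω t).1 =
      (binSurplus δ (t % n) - δ) +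
        if 0 ≤ h.binTotal (t % n) ω then binExcess δ (t % n) (ω t) else 0 := by
    intro t
    show reward (a.1 (binValue δ (t % n))) (binValue δ (t % n)) (ω t).1 = _
    have hi := h.mod_lt t
    have hai := ha _ hi
    have e1 := coe_binValue h.pos h.n_mul_le hi.le
    have e2 := coe_gridPoint h.pos h.n_mul_le hi.le
    have e3 := coe_gridPoint h.pos h.n_mul_le (Nat.succ_le_of_lt hi)
    have hlt := gridPoint_lt_succ h.pos h.n_mul_le hi
    by_cases hc : 0 ≤ h.binTotal (t % n) ω
    · rw [if_pos hc] at hai ⊢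
      have hb : a.1 (binValue δ (t % n)) = gridPoint δ (t % n) := Subtype.ext (by
        rw [hai, e2]; ring)
      rw [hb, reward, binExcess]
      rcases hω t with e | e <;> rw [e]
      · simp only [le_refl, if_true]
        rw [e1, e2, binSurplus]; ring
      · simp only
        rw [if_neg hlt.not_ge, if_neg hlt.not_ge]; ring
    · rw [if_neg hc] at hai ⊢
      have hb : a.1 (binValue δ (t % n)) = gridPoint δ (t % n + 1) := Subtype.ext (by
        rw [hai, e3]; push_cast; ring)
      rw [hb, reward]
      have hm : (ω t).1 ≤ gridPoint δ (t % n + 1) := by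
        rcases hω t with e | e <;> rw [e]
        exact hlt.le
      rw [if_pos hm, e1, e3, binSurplus]
      push_cast; ring
  simp only [h1, Finset.sum_add_distrib]
  congr 1
  rw [← Finset.sum_fiberwise_of_maps_to (s := Finset.univ) (t := Finset.range n)
    (g := fun t : Fin T => (t : ℕ) % n) (fun t _ => Finset.mem_range.2 (h.mod_lt t))]
  refine Finset.sum_congr rfl fun i _ => ?_
  have h2 : ∀ t ∈ Finset.univ.filter (fun t : Fin T => (t : ℕ) % n = i),
      (if 0 ≤ h.binTotal (t % n) ω then binExcess δ (t % n) (ω t) else 0) =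
      if 0 ≤ h.binTotal i ω then binExcess δ (t % n) (ω t) else 0 := by
    intro t ht
    rw [(Finset.mem_filter.1 ht).2]
  rw [Finset.sum_congr rfl h2]
  by_cases hc : 0 ≤ h.binTotal i ω
  · simp only [hc, if_true, max_eq_left]
    rfl
  · simp only [hc, if_false, Finset.sum_const_zero]
    exact max_eq_right (not_le.1 hc).le

/-- The current competing bid is not part of the history, and the hint is the same in both outcomes
of a bin, so the bidder cannot tell them apart. -/
lemma history_update (t : Fin T) (ω : Fin T → I × I) (m m' y : I) :
    h.env.history (Function.update ω t (m, y)) t = h.env.history (Function.update ω t (m', y)) t := by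
  unfold Environment.history
  refine Prod.ext (funext fun s => ?_) (funext fun s => ?_)
  · by_cases hs : s.1 = t
    · simp [hs]
    · simp [hs]
  · have hs : s.1 ≠ t := ne_of_lt s.2
    simp [hs]

lemma integral_gain_le (π : Policy T) :
    ∫ ω, h.env.gain π ω ∂(hardLaw T n δ) ≤ ∑ t : Fin T, (binSurplus δ (t % n) - δ) := by
  have := h.isProb
  have hp : IsProbabilityMeasure (hardLaw T n δ) := h.env.isProb
  have hmeas : ∀ t : Fin T, Measurable fun ω : Fin T → I × I =>
      ∫ b, reward b (h.env.v t) (ω t).1 ∂(π.bid t (h.env.history ω t)) :=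
    fun t => h.env.measurable_roundGain π t
  unfold Environment.gain
  rw [integral_finsetSum _ fun t _ =>
    integrable_of_abs_le (hmeas t) fun ω => abs_integral_reward_le π _ _ _]
  refine Finset.sum_le_sum fun t _ => ?_
  rw [hardLaw, integral_pi_eq_integral_update _ t (hmeas t)
    fun ω => abs_integral_reward_le π _ _ _]
  have hle : ∀ ω : Fin T → I × I, ∫ y, ∫ b, reward b (h.env.v t) (Function.update ω t y t).1
      ∂(π.bid t (h.env.history (Function.update ω t y) t)) ∂(binLaw δ (t % n)) ≤
      binSurplus δ (t % n) - δ := by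
    intro ω
    have := π.isMarkov t
    rw [integral_binLaw h.pos h.le_eighth,
      h.history_update t ω (gridPoint δ (t % n + 1)) (gridPoint δ (t % n)) (gridPoint δ (t % n))]
    simp only [Function.update_self]
    set κ := π.bid t (h.env.history (Function.update ω t (gridPoint δ (t % n), gridPoint δ (t % n))) t)
    have hint : ∀ m : I, Integrable (fun b => reward b (h.env.v t) m) κ := fun m =>
      integrable_of_abs_le (measurable_reward_comp measurable_id measurable_const measurable_const)
        fun b => abs_reward_le _ _ _
    rw [← integral_const_mul, ← integral_const_mul,
      ← integral_add ((hint _).const_mul _) ((hint _).const_mul _)]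
    calc _ ≤ ∫ _b, (binSurplus δ (t % n) - δ) ∂κ :=
          integral_mono (((hint _).const_mul _).fun_add ((hint _).const_mul _)) (integrable_const _)
            fun b => expected_reward_le h.pos h.le_eighth h.n_mul_le (h.mod_lt t) b
      _ = _ := by simp
  have h0 : 0 ≤ binSurplus δ (t % n) - δ := by
    linarith [half_le_binSurplus (i := t % n) h.pos, h.le_eighth]
  -- If the inner integral were not integrable, the outer one would be `0` by convention, still
  -- below the nonnegative bound.
  by_cases hi : Integrable (fun ω : Fin T → I × I => ∫ y, ∫ b, reward b (h.env.v t)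
      (Function.update ω t y t).1 ∂(π.bid t (h.env.history (Function.update ω t y) t))
        ∂(binLaw δ (t % n))) (hardLaw T n δ)
  · calc _ ≤ ∫ _ω, (binSurplus δ (t % n) - δ) ∂(hardLaw T n δ) :=
          integral_mono hi (integrable_const _) hle
      _ = _ := by simp
  · rw [← hardLaw, integral_undef hi]
    exact h0

lemma div_le_card_bin {i : ℕ} (hi : i < n) :
    T / n ≤ (Finset.univ.filter (fun t : Fin T => (t : ℕ) % n = i)).card := by
  have hlt : ∀ k < T / n, i + n * k < T := fun k hk => by
    have h1 : n * (k + 1) ≤ n * (T / n) := Nat.mul_le_mul_left n hk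
    have h2 := Nat.mul_div_le T n
    rw [mul_add] at h1
    omega
  calc T / n = (Finset.univ : Finset (Fin (T / n))).card := by simp
    _ ≤ _ := Finset.card_le_card_of_injOn (fun k => ⟨i + n * k, hlt k k.2⟩)
        (fun k _ => by simp [Nat.mod_eq_of_lt hi]) fun k _ l _ hkl => by
          have h1 : i + n * (k : ℕ) = i + n * l := congrArg Fin.val hkl
          have h2 : n * (k : ℕ) = n * l := by omega
          exact Fin.ext (Nat.eq_of_mul_eq_mul_left h.one_le_n h2)

lemma integral_max_binTotal_ge {i : ℕ} (hi : i < n) :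
    √(3 * δ * T / (16 * n)) / 20 ≤ ∫ ω, max (h.binTotal i ω) 0 ∂(hardLaw T n δ) := by
  have := h.isProb
  have hp : IsProbabilityMeasure (hardLaw T n δ) := h.env.isProb
  have hδ := h.pos
  have hδ8 := h.le_eighth
  have hn0 : (0 : ℝ) < n := by exact_mod_cast h.one_le_n
  obtain ⟨m1, m2, m4⟩ := moments_sum_of_iIndepFun (μ := hardLaw T n δ)
    (X := fun (t : Fin T) ω => binExcess δ (t % n) (ω t))
    (iIndepFun_pi fun t => (measurable_binExcess δ (t % n)).aemeasurable)
    (fun t => (measurable_binExcess _ _).comp (measurable_pi_apply t))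
    (fun t ω => abs_binExcess_le hδ hδ8 h.n_mul_le (h.mod_lt t).le _)
    (fun t => by
      rw [h.integral_eval t (measurable_binExcess _ _),
        integral_binExcess hδ hδ8 h.n_mul_le (h.mod_lt t)])
    (Finset.univ.filter (fun t : Fin T => (t : ℕ) % n = i))
  set V := ∑ t ∈ Finset.univ.filter (fun t : Fin T => (t : ℕ) % n = i),
    ∫ ω, binExcess δ (t % n) (ω t) ^ 2 ∂(hardLaw T n δ) with hVdef
  have hterm : ∀ t : Fin T, 3 / 8 * δ ≤ ∫ ω, binExcess δ (t % n) (ω t) ^ 2 ∂(hardLaw T n δ) := by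
    intro t
    rw [h.integral_eval t (f := fun y => binExcess δ (t % n) y ^ 2)
      ((measurable_binExcess _ _).pow_const 2), integral_binExcess_sq hδ hδ8 h.n_mul_le (h.mod_lt t)]
    have := half_le_binSurplus (i := t % n) hδ
    nlinarith
  have hV1 : (T / n : ℕ) * (3 / 8 * δ) ≤ V := by
    calc _ ≤ ((Finset.univ.filter (fun t : Fin T => (t : ℕ) % n = i)).card : ℝ) * (3 / 8 * δ) :=
          mul_le_mul_of_nonneg_right (by exact_mod_cast h.div_le_card_bin hi) (by positivity)
      _ = ∑ t ∈ Finset.univ.filter (fun t : Fin T => (t : ℕ) % n = i), 3 / 8 * δ := by simp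
      _ ≤ V := Finset.sum_le_sum fun t _ => hterm t
  have hnT : n ≤ T := by
    have h1 : (8 * δ * T : ℝ) ≤ T := by nlinarith [(Nat.cast_nonneg T : (0 : ℝ) ≤ T)]
    exact_mod_cast h.n_le.trans h1
  -- Rounding down `T / n ≥ 1` loses at most a factor `2`.
  have hfloor : (T : ℝ) / (2 * n) ≤ (T / n : ℕ) := by
    rw [div_le_iff₀ (by positivity)]
    have h1 : 1 ≤ T / n := (Nat.one_le_div_iff h.one_le_n).2 hnT
    have h2 := Nat.div_add_mod T n
    have h3 := h.mod_lt T
    have h4 : T ≤ T / n * (2 * n) := by nlinarith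
    exact_mod_cast h4
  have hV2 : 3 * δ * T / (16 * n) ≤ V := by
    refine le_trans (le_of_eq ?_) ((mul_le_mul_of_nonneg_right hfloor
      (by positivity : 0 ≤ 3 / 8 * δ)).trans hV1)
    field_simp
    ring
  -- Then `V ≤ (128/3) V²`, so `3V² + V ≤ 46 V²`.
  have hV3 : 3 / 128 ≤ V := by
    refine le_trans ?_ hV2
    rw [le_div_iff₀ (by positivity)]
    linarith [h.n_le]
  refine le_trans (by gcongr) (integral_max_zero_ge (h.measurable_binTotal i)
    (h.abs_binTotal_le i) m1 (by linarith) m2 (m4.trans (by nlinarith)))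

theorem regret_ge (π : Policy T) : √(n * (8 * δ * T)) / 140 ≤ regret π h.env := by
  have hp : IsProbabilityMeasure (hardLaw T n δ) := h.env.isProb
  have hn0 : (0 : ℝ) < n := by exact_mod_cast h.one_le_n
  have hδ := h.pos
  have hint : ∀ i, Integrable (fun ω => max (h.binTotal i ω) 0) (hardLaw T n δ) := fun i =>
    integrable_of_abs_le (C := T) ((h.measurable_binTotal i).max measurable_const) fun ω => by
      refine le_trans ?_ (h.abs_binTotal_le i ω)
      rw [abs_of_nonneg (le_max_right _ _)]
      exact max_le (le_abs_self _) (abs_nonneg _)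
  have h1 := integral_mono_ae ((integrable_const _).fun_add
    (integrable_finsetSum (Finset.range n) fun i _ => hint i)) h.env.integrable_best h.best_ge
  rw [integral_add (integrable_const _) (integrable_finsetSum (Finset.range n) fun i _ => hint i),
    integral_finsetSum _ fun i _ => hint i] at h1
  have h2 := h.integral_gain_le π
  have h3 : (n : ℝ) * (√(3 * δ * T / (16 * n)) / 20) ≤
      ∑ i ∈ Finset.range n, ∫ ω, max (h.binTotal i ω) 0 ∂(hardLaw T n δ) := by
    calc _ = ∑ i ∈ Finset.range n, √(3 * δ * T / (16 * n)) / 20 := by simp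
      _ ≤ _ := Finset.sum_le_sum fun i hi => h.integral_max_binTotal_ge (Finset.mem_range.1 hi)
  have h4 : √(n * (8 * δ * T)) / 140 ≤ (n : ℝ) * (√(3 * δ * T / (16 * n)) / 20) := by
    have h5 : (n : ℝ) * √(3 * δ * T / (16 * n)) = √(n * (3 * δ * T / 16)) := by
      rw [← Real.sqrt_sq hn0.le, ← Real.sqrt_mul (by positivity), Real.sqrt_sq hn0.le]
      congr 1
      field_simp
    -- `8 ≤ 49 · 3/16`, and `7 · 20 = 140`.
    have h6 : √(n * (8 * δ * T)) ≤ 7 * √(n * (3 * δ * T / 16)) := by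
      refine Real.sqrt_le_iff.2 ⟨by positivity, ?_⟩
      rw [mul_pow, Real.sq_sqrt (by positivity)]
      have : 0 ≤ n * (δ * T) := by positivity
      nlinarith
    rw [mul_div_assoc', h5]
    linarith
  have h7 : regret π h.env = ∫ ω, h.env.best ω ∂(hardLaw T n δ) -
      ∫ ω, h.env.gain π ω ∂(hardLaw T n δ) := regret_eq π h.env
  simp only [integral_const, probReal_univ, one_smul] at h1
  rw [h7]
  linarith

end HardParams

/-! ### Choice of parameters and conclusion. -/

theorem minimaxRegret_lower_bound (hT : 1 ≤ T) (hK : 2 ≤ K) (hq : 1 ≤ q) (hL : 1 ≤ L)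
    (hLT : L ≤ T) :
    ((1 / 280 * min (√(hintRate T q L * (K : ℝ))) (min (hintRate T q L) (√(T : ℝ))) : ℝ) : EReal) ≤
      minimaxRegret T K q L := by
  have hT' : (0 : ℝ) < T := by exact_mod_cast hT
  have hK' : (2 : ℝ) ≤ K := by exact_mod_cast hK
  have hH1 := one_le_hintRate hT hq hL
  set H := hintRate T q L with hH
  have hLT0 : 0 < L / T := by positivity
  -- Up to the factor `8`, the largest step the hint constraint allows: `(8δ) ^ (q+1) = (L/T) ^ q`,
  -- and `8 δ T = H`.
  set δ := (L / T) ^ (q / (q + 1)) / 8 with hδ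
  have hδ0 : 0 < δ := by positivity
  have hδ8 : δ ≤ 1 / 8 := by
    have : (L / T) ^ (q / (q + 1)) ≤ 1 :=
      Real.rpow_le_one hLT0.le ((div_le_one hT').2 hLT) (by positivity)
    linarith
  have hHδ : 8 * δ * T = H := by
    rw [hδ, hH, hintRate, Real.div_rpow (by linarith) hT'.le]
    have h1 : (T : ℝ) = (T : ℝ) ^ (1 / (q + 1)) * (T : ℝ) ^ (q / (q + 1)) := by
      rw [← Real.rpow_add hT', ← add_div, add_comm 1 q, div_self (by linarith), Real.rpow_one]
    have h2 : (0 : ℝ) < (T : ℝ) ^ (q / (q + 1)) := by positivity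
    have h3 : L ^ (q / (q + 1)) / (T : ℝ) ^ (q / (q + 1)) * T =
        (T : ℝ) ^ (1 / (q + 1)) * L ^ (q / (q + 1)) := by
      rw [div_mul_eq_mul_div, div_eq_iff h2.ne']
      nth_rewrite 1 [h1]
      ring
    rw [← h3]; ring
  -- The three caps on the number of bins come from sparsity, from room in `[0,1]` and from the
  -- variance per bin; `√(xH)` matches the three terms in the same order as `√(HK)`, `√T` and `H`.
  set x := min ((K : ℝ) - 1) (min (1 / (4 * δ)) H) with hx
  have hx1 : 1 ≤ x := by
    refine le_min (by linarith) (le_min ?_ hH1)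
    rw [le_div_iff₀ (by positivity)]; linarith
  set n := ⌊x⌋₊ with hn
  have hn1 : 1 ≤ n := Nat.le_floor (by simpa using hx1)
  have hn1' : (1 : ℝ) ≤ n := by exact_mod_cast hn1
  have hnx : (n : ℝ) ≤ x := Nat.floor_le (by linarith)
  have hxn : x ≤ 2 * n := by linarith [Nat.lt_floor_add_one x]
  have hp : HardParams T K q L n δ :=
    { one_le_T := hT
      one_le_n := hn1
      n_lt_K := by
        have : (n : ℝ) + 1 ≤ K := by linarith [min_le_left ((K : ℝ) - 1) (min (1 / (4 * δ)) H)]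
        exact_mod_cast this
      pos := hδ0
      le_eighth := hδ8
      n_mul_le := by
        have h1 : (n : ℝ) ≤ 1 / (4 * δ) :=
          hnx.trans ((min_le_right _ _).trans (min_le_left _ _))
        rw [le_div_iff₀ (by positivity)] at h1
        linarith
      n_le := by
        rw [hHδ]; exact hnx.trans ((min_le_right _ _).trans (min_le_right _ _))
      one_le_q := hq
      nonneg := by linarith
      hint := by
        have h1 : (L / T) ^ q = 8 * δ * (8 * δ) ^ q := by
          rw [hδ, mul_div_cancel₀ _ (by norm_num), ← Real.rpow_mul hLT0.le, ← Real.rpow_add hLT0]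
          congr 1; field_simp; ring
        rw [h1]
        refine mul_le_mul (by linarith) ?_ (by positivity) (by positivity)
        exact Real.rpow_le_rpow hδ0.le (by linarith) (by linarith) }
  refine le_minimaxRegret hp.env fun π => le_trans ?_ (hp.regret_ge π)
  rw [hHδ]
  set M := min (√(H * (K : ℝ))) (min H (√(T : ℝ))) with hM
  have hM0 : 0 ≤ M := le_min (Real.sqrt_nonneg _) (le_min (by linarith) (Real.sqrt_nonneg _))
  have hm1 : M ^ 2 ≤ H * K := by
    have := pow_le_pow_left₀ hM0 (min_le_left (√(H * (K : ℝ))) (min H (√(T : ℝ)))) 2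
    rwa [Real.sq_sqrt (by positivity)] at this
  have hm2 : M ^ 2 ≤ H * H := by
    have := pow_le_pow_left₀ hM0 ((min_le_right (√(H * (K : ℝ))) (min H (√(T : ℝ)))).trans
      (min_le_left _ _)) 2
    rwa [sq H] at this
  have hm3 : M ^ 2 ≤ T := by
    have := pow_le_pow_left₀ hM0 ((min_le_right (√(H * (K : ℝ))) (min H (√(T : ℝ)))).trans
      (min_le_right _ _)) 2
    rwa [Real.sq_sqrt hT'.le] at this
  have hH0 : 0 < H := by linarith
  -- Uses `K ≤ 2(K - 1)` and `T / H = 1/(8δ)`. With `x ≤ 2n` it gives `M² ≤ 4nH`, hence `280 = 2 ·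
  -- 140`.
  have hkey : M ^ 2 ≤ H * (2 * x) := by
    rw [← div_le_iff₀' hH0, ← div_le_iff₀' (by norm_num : (0 : ℝ) < 2)]
    refine le_min ?_ (le_min ?_ ?_)
    · have := (div_le_iff₀' hH0).2 hm1
      linarith
    · have : M ^ 2 / H ≤ T / H := by gcongr
      have h2 : (T : ℝ) / H = 1 / (8 * δ) := by rw [← hHδ]; field_simp
      rw [h2] at this
      have h3 : 1 / (8 * δ) = 1 / (4 * δ) / 2 := by field_simp; norm_num
      have h4 : 0 < 1 / (4 * δ) := by positivity
      linarith
    · have := (div_le_iff₀' hH0).2 hm2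
      linarith
  have hfin : M / 2 ≤ √(n * H) := by
    refine Real.le_sqrt_of_sq_le ?_
    nlinarith
  linarith

end hard

end FirstPrice

theorem theorem5 :
    (∃ C : ℝ, 0 < C ∧ ∀ (T K : ℕ) (q L : ℝ), 2 ≤ T → 1 ≤ K → 1 ≤ q → 1 ≤ L → L ≤ (T : ℝ) →
      FirstPrice.minimaxRegret T K q L ≤
        ((C * min (√(Real.log (T : ℝ) * FirstPrice.hintRate T q L * (K : ℝ)))
          (min (FirstPrice.hintRate T q L)
            (√(T : ℝ) * (1 + Real.log (min (K : ℝ) (T : ℝ))))) : ℝ) : EReal)) ∧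
    (∃ c : ℝ, 0 < c ∧ ∀ (T K : ℕ) (q L : ℝ), 1 ≤ T → 2 ≤ K → 1 ≤ q → 1 ≤ L → L ≤ (T : ℝ) →
      ((c * min (√(FirstPrice.hintRate T q L * (K : ℝ)))
          (min (FirstPrice.hintRate T q L) (√(T : ℝ))) : ℝ) : EReal) ≤
        FirstPrice.minimaxRegret T K q L) := by
  refine ⟨⟨142, by norm_num, fun T K q L hT hK hq hL _ => ?_⟩,
    ⟨1 / 280, by norm_num, fun T K q L hT hK hq hL hLT => ?_⟩⟩
  · exact FirstPrice.minimaxRegret_upper_bound hT hK hq hL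
  · exact FirstPrice.minimaxRegret_lower_bound hT hK hq hL hLT
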